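/- Let $n$ be a positive integer, let $\Lambda$ be an artin algebra (an algebra that is finitely generated as a module over a commutative artinian ring), and let $\Lambda\text{-mod}$ be the category of finitely generated left $\Lambda$-modules. Let $\mathcal M$ be an $n$-cluster tilting subcategory of $\Lambda\text{-mod}$, that is, a generating, cogenerating and functorially finite full subcategory with $$\mathcal M=\{Y \mid \operatorname{Ext}^i(\mathcal M,Y)=0 \text{ for all } 0<i<n\}=\{X \mid \operatorname{Ext}^i(X,\mathcal M)=0\text{ for all } 0<i<n\}.$$ Let $\{U_\alpha\}_{\alpha\in J}$ be a complete set of representatives of the isomorphism classes of indecomposable modules in $\mathcal M$, put $U=\bigoplus_{\alpha\in J}U_\alpha$, and let $e_\alpha\colon U\to U_\alpha\to U$ be the canonical projection followed by the canonical injection. Let $T$ be the functor (Gabriel) ring of $\mathcal M$: the ring, in general without unit, of all $f\in\operatorname{End}_\Lambda(U)$ with $e_\alpha f=0$ for almost all $\alpha\in J$, where maps are written on the right (so $fg$ means $f$ followed by $g$). Then $\operatorname{w.gl.dim}(T)\le n+1$. That is, for every unitary left $T$-module $N$ (one with $TN=N$) there are some $m\le n+1$ and an exact sequence $0\to F_m\to\cdots\to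 F_0\to N\to 0$ of unitary left $T$-modules in which each $F_i$ is flat, i.e. $-\otimes_T F_i$ is an exact functor from unitary right $T$-modules to abelian groups. -/

import Mathlib

open CategoryTheory CategoryTheory.Limits
open scoped DirectSum TensorProduct

universe u v w

/-! ### `n`-cluster tilting subcategories of an abelian category -/

section ClusterTilting

variable {A : Type u} [Category.{v} A] [Abelian A]

/-- A full subcategory (given by its property of objects) is generating if every object is a
quotient of an object of the subcategory. -/
def IsGeneratingSubcat (M : ObjectProperty A) : Prop :=
  ∀ X : A, ∃ (Y : A) (f : Y ⟶ X), M Y ∧ Epi f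

/-- A full subcategory is cogenerating if every object is a subobject of an object of the
subcategory. -/
def IsCogeneratingSubcat (M : ObjectProperty A) : Prop :=
  ∀ X : A, ∃ (Y : A) (f : X ⟶ Y), M Y ∧ Mono f

/-- Every object has a right `M`-approximation. -/
def IsContravariantlyFinite (M : ObjectProperty A) : Prop :=
  ∀ X : A, ∃ (Y : A) (θ : Y ⟶ X), M Y ∧
    ∀ (Y' : A) (g : Y' ⟶ X), M Y' → ∃ h : Y' ⟶ Y, h ≫ θ = g

/-- Every object has a left `M`-approximation. -/
def IsCovariantlyFinite (M : ObjectProperty A) : Prop :=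
  ∀ X : A, ∃ (Y : A) (θ : X ⟶ Y), M Y ∧
    ∀ (Y' : A) (g : X ⟶ Y'), M Y' → ∃ h : Y ⟶ Y', θ ≫ h = g

/-- `Ext^i(X, Y) = 0` in the abelian category `A` (Yoneda/derived-category `Ext`). -/
def ExtVanishes (X Y : A) (i : ℕ) : Prop :=
  haveI : HasExt.{max u v} A := HasExt.standard A
  Subsingleton (Abelian.Ext.{max u v} X Y i)

/-- `M^{⊥ₙ}`: the objects `Y` with `Ext^i(M, Y) = 0` for all `0 < i < n`. -/
def rightPerp (n : ℕ) (M : ObjectProperty A) : ObjectProperty A := fun Y =>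
  ∀ i : ℕ, 0 < i → i < n → ∀ X : A, M X → ExtVanishes X Y i

/-- `^{⊥ₙ}M`: the objects `X` with `Ext^i(X, M) = 0` for all `0 < i < n`. -/
def leftPerp (n : ℕ) (M : ObjectProperty A) : ObjectProperty A := fun X =>
  ∀ i : ℕ, 0 < i → i < n → ∀ Y : A, M Y → ExtVanishes X Y i

/-- `n`-cluster tilting (full) subcategories of an abelian category. -/
structure IsNClusterTilting (n : ℕ) (M : ObjectProperty A) : Prop where
  generating : IsGeneratingSubcat M
  cogenerating : IsCogeneratingSubcat M
  contravariantlyFinite : IsContravariantlyFinite M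
  covariantlyFinite : IsCovariantlyFinite M
  rightPerp_eq : rightPerp n M = M
  leftPerp_eq : leftPerp n M = M

/-- `(U α)` is a complete set of representatives of the isomorphism classes of indecomposable
objects of `M`. -/
structure IsCompleteIndecomposableFamily (M : ObjectProperty A) {J : Type w} (U : J → A) :
    Prop where
  mem : ∀ α, M (U α)
  indecomposable : ∀ α, Indecomposable (U α)
  eq_of_iso : ∀ α β, Nonempty (U α ≅ U β) → α = β
  complete : ∀ X : A, M X → Indecomposable X → ∃ α, Nonempty (X ≅ U α)

end ClusterTilting

/-! ### Artin algebras -/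

/-- `Λ` is an artin algebra: it is an algebra over a commutative artinian ring `k` and finitely
generated as a `k`-module. (One may replace `k` by its image in `Λ`, so that
it is no restriction to take `k` in the universe of `Λ`.) -/
class IsArtinAlgebra (Λ : Type u) [Ring Λ] : Prop where
  exists_base : ∃ (k : Type u) (_ : CommRing k) (_ : IsArtinianRing k) (_ : Algebra k Λ),
    Module.Finite k Λ

/-- Artin algebras are left noetherian; hence the category of finitely generated left modules is
abelian. -/
instance IsArtinAlgebra.isNoetherianRing (Λ : Type u) [Ring Λ] [IsArtinAlgebra Λ] :
    IsNoetherianRing Λ := by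
  obtain ⟨k, _, _, _, _⟩ := IsArtinAlgebra.exists_base (Λ := Λ)
  have : IsNoetherian k Λ := inferInstance
  exact isNoetherian_of_tower k this

/-! ### The functor ring -/

section FunctorRing

variable {Λ : Type u} [Ring Λ] {J : Type w} (U : J → FGModuleCat.{u} Λ)

open Classical in
/-- The idempotent endomorphism `e_α` of `⨁ U_α`: the projection onto `U_α` followed by the
injection of `U_α`. -/
noncomputable def summandIdempotent (α : J) : Module.End Λ (⨁ α, (U α : Type u)) :=
  DirectSum.lof Λ J (fun α => (U α : Type u)) α ∘ₗ
    DirectSum.component Λ J (fun α => (U α : Type u)) α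

/-- The functor ring of the family `U`: the endomorphisms `f` of `⨁ U_α` with `e_α f = 0` for
almost all `α`. Maps are written on the right, so that `f g` is `f` followed by `g`: this is the
multiplication of the opposite of `Module.End`. There is in general no unit. -/
noncomputable def functorRing : NonUnitalSubring (Module.End Λ (⨁ α, (U α : Type u)))ᵐᵒᵖ where
  carrier := {f | {α : J | MulOpposite.op (summandIdempotent U α) * f ≠ 0}.Finite}
  zero_mem' := by simp
  add_mem' := by
    intro f g hf hg
    refine (hf.union hg).subset fun α hα => ?_
    by_contra h
    simp only [Set.mem_union, Set.mem_ofPred_eq, not_or, not_not] at h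
    exact hα (by rw [mul_add, h.1, h.2, add_zero])
  neg_mem' := by
    intro f hf
    refine hf.subset fun α hα h => hα ?_
    exact (mul_neg _ f).trans (by rw [h, neg_zero])
  mul_mem' := by
    intro f g hf _
    refine hf.subset fun α hα h => hα ?_
    rw [← mul_assoc, h, zero_mul]

end FunctorRing

/-! ### Unitary modules over a ring without unit -/

/-- The action of a left module over a ring `T` that need not have a unit. A right `T`-module is a
left module over `Tᵐᵒᵖ`. -/
class NonUnitalModule (T : Type u) [NonUnitalRing T] (N : Type v) [AddCommGroup N]
    extends SMul T N where
  smul_add : ∀ (t : T) (x y : N), t • (x + y) = t • x + t • y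
  add_smul : ∀ (s t : T) (x : N), (s + t) • x = s • x + t • x
  mul_smul : ∀ (s t : T) (x : N), (s * t) • x = s • t • x

/-- Unitary left `T`-modules, that is, modules `N` with `T N = N`, where `T N` is the set of
finite sums of elements `t n`. -/
structure UnitaryMod (T : Type u) [NonUnitalRing T] where
  carrier : Type u
  [addCommGroup : AddCommGroup carrier]
  [module : NonUnitalModule T carrier]
  unitary : AddSubgroup.closure {x : carrier | ∃ (t : T) (n : carrier), t • n = x} = ⊤

namespace UnitaryMod

variable {T : Type u} [NonUnitalRing T]

instance : CoeSort (UnitaryMod T) (Type u) := ⟨carrier⟩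

attribute [instance] addCommGroup module

/-- Homomorphisms of `T`-modules. -/
structure Hom (X Y : UnitaryMod T) where
  toFun : X →+ Y
  map_smul : ∀ (t : T) (x : X), toFun (t • x) = t • toFun x

/-- The sequence `0 → X → Y → Z → 0` is exact. -/
def ShortExact {X Y Z : Type u} [AddCommGroup X] [AddCommGroup Y] [AddCommGroup Z]
    (f : X →+ Y) (g : Y →+ Z) : Prop :=
  Function.Injective f ∧ Function.Exact f g ∧ Function.Surjective g

/-- The subgroup of `X ⊗_ℤ N` generated by the elements `xt ⊗ n - x ⊗ tn`. -/
def tensorRel (X : UnitaryMod Tᵐᵒᵖ) (N : UnitaryMod T) : AddSubgroup (X ⊗[ℤ] N) :=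
  AddSubgroup.closure
    {z | ∃ (x : X) (t : T) (n : N), z = (MulOpposite.op t • x) ⊗ₜ[ℤ] n - x ⊗ₜ[ℤ] (t • n)}

/-- The tensor product `X ⊗_T N` of a right and a left `T`-module. -/
abbrev tensor (X : UnitaryMod Tᵐᵒᵖ) (N : UnitaryMod T) : Type u := (X ⊗[ℤ] N) ⧸ tensorRel X N

/-- The map `f ⊗ N : X ⊗_T N → Y ⊗_T N`. -/
noncomputable def tensorMap {X Y : UnitaryMod Tᵐᵒᵖ} (f : Hom X Y) (N : UnitaryMod T) :
    tensor X N →+ tensor Y N :=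
  QuotientAddGroup.map (tensorRel X N) (tensorRel Y N)
    (TensorProduct.map f.toFun.toIntLinearMap (LinearMap.id : N →ₗ[ℤ] N)).toAddMonoidHom (by
      rw [tensorRel, AddSubgroup.closure_le]
      rintro z ⟨x, t, n, rfl⟩
      refine AddSubgroup.subset_closure ⟨f.toFun x, t, n, ?_⟩
      simp [f.map_smul])

/-- `N` is flat: the functor `- ⊗_T N` from unitary right `T`-modules to abelian groups is
exact. -/
def IsFlat (N : UnitaryMod T) : Prop :=
  ∀ (X Y Z : UnitaryMod Tᵐᵒᵖ) (f : Hom X Y) (g : Hom Y Z),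
    ShortExact f.toFun g.toFun → ShortExact (tensorMap f N) (tensorMap g N)

/-- There is an exact sequence `0 → F_m → ⋯ → F_1 → F_0 → N → 0` of unitary left `T`-modules with
all `F_i` flat (the sequence is continued by `F_i = 0` for `i > m`). -/
def HasFlatResolution (N : UnitaryMod T) (m : ℕ) : Prop :=
  ∃ (F : ℕ → UnitaryMod T) (d : ∀ i, Hom (F (i + 1)) (F i)) (ε : Hom (F 0) N),
    (∀ i, IsFlat (F i)) ∧ (∀ i, m < i → Subsingleton (F i)) ∧
    Function.Surjective ε.toFun ∧ Function.Exact (d 0).toFun ε.toFun ∧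
    ∀ i, Function.Exact (d (i + 1)).toFun (d i).toFun

/-- The flat dimension, `⊤` if there is no finite flat resolution. -/
noncomputable def flatDim (N : UnitaryMod T) : ℕ∞ :=
  sInf {d : ℕ∞ | ∃ m : ℕ, d = m ∧ HasFlatResolution N m}

end UnitaryMod

/-- The weak global dimension of `T`: the supremum of the flat dimensions of all unitary left
`T`-modules. (Meant for rings with enough idempotents, such as functor rings.) -/
noncomputable def weakGlobalDim (T : Type u) [NonUnitalRing T] : ℕ∞ :=
  ⨆ N : UnitaryMod T, N.flatDim

/-! ### Modules over rings with local units -/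

/-! Unitary `T`-modules are treated as modules over the ring `R` obtained by adjoining a unit to
`T`. Finite sums of the `e_α` are local units of `T`, so a unitary module is one in which every
element is fixed by an element of `T`.

The homological core is that a finitely presented unitary module `F` has projective dimension at
most `n + 1`. For `A` in `M`, the maps `⨁ U_α → A` vanishing on almost all summands form a finitely
generated projective module `finiteHom U A`, and linear maps out of it come from maps out of `A`
(Yoneda). Hence `F` is presented by a map `d : B₁ ⟶ B₀` in `M`, and left exactness identifies the
second syzygy with `finiteHom U (kernel d)`. Right `M`-approximations resolve `kernel d`: each
kernel gains one degree of vanishing `Ext`, so after `n - 1` of them the kernel lies in `M^{⊥ₙ} =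
M`. The second syzygy thus has projective dimension at most `n - 1`. The steps are
`isRepresentableProjective`, `exists_approximation`, `hasProjectiveDimensionLT_finiteHom` and
`exists_cover`.

The passage to arbitrary unitary `N` avoids direct limits and Tor. The condition
`FactorsThroughProjDim T d N` holds when all finitely presented unitary modules have projective
dimension at most `d`. It drops to `d - 1` on the kernel of a projective cover
(`FactorsThroughProjDim.ker`), and for `d = 0` it implies flatness by an equational criterion
(`isFlat_of_factorsThroughProjDim_zero`). Splicing projective covers then gives a flat resolution of
length `d`. -/

section LocalUnits

/-- A ring has local units if every finite subset has an idempotent that is a two-sided unit for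
its elements. -/
def HasLocalUnits (T : Type u) [NonUnitalRing T] : Prop :=
  ∀ s : Finset T, ∃ e : T, e * e = e ∧ ∀ t ∈ s, e * t = t ∧ t * e = t

variable {T : Type u} [NonUnitalRing T]

variable (T) in
/-- The ring obtained from `T` by adjoining a unit. -/
def Unitalization : Type u := Unitization ℤ T

local notation "R" => Unitalization T

namespace Unitalization

instance : Ring (Unitalization T) := inferInstanceAs (Ring (Unitization ℤ T))

/-- The inclusion of `T` into its unitalization. -/
def of : T →ₙ+* R where
  toFun := fun t => (Unitization.inr t : Unitization ℤ T)
  map_mul' := Unitization.inr_mul ℤ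
  map_zero' := Unitization.inr_zero ℤ
  map_add' := Unitization.inr_add ℤ

theorem exists_of_mul_eq (t : T) (r : R) : ∃ t' : T, of t * r = of t' := by
  refine ⟨r.toProd.1 • t + t * r.toProd.2, ?_⟩
  refine Unitization.ext (?_ : (0 : ℤ) * _ = 0) ?_
  · simp
  · change (0 : ℤ) • r.toProd.2 + r.toProd.1 • t + t * r.toProd.2 = _ • t + t * _
    simp

theorem exists_mul_of_eq (r : R) (t : T) : ∃ t' : T, r * of t = of t' := by
  refine ⟨r.toProd.1 • t + r.toProd.2 * t, ?_⟩
  refine Unitization.ext (?_ : _ * (0 : ℤ) = 0) ?_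
  · simp
  · change r.toProd.1 • t + (0 : ℤ) • r.toProd.2 + r.toProd.2 * t = _ • t + _ * t
    simp

theorem exists_eq_zsmul_add (r : R) : ∃ (z : ℤ) (t : T), r = z • 1 + of t := by
  refine ⟨r.toProd.1, r.toProd.2, Unitization.ext ?_ ?_⟩
  · change _ = r.toProd.1 * 1 + 0
    simp
  · change _ = r.toProd.1 • (0 : T) + r.toProd.2
    simp

end Unitalization

open Unitalization (of)

variable (T) in
/-- A module over the unitalization of `T` is unitary over `T`. -/
def IsUnitary (N : Type v) [AddCommGroup N] [Module R N] : Prop :=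
  ∀ x : N, ∃ t : T, of t • x = x

namespace HasLocalUnits

theorem exists_unit (h : HasLocalUnits T) {N : Type v} [AddCommGroup N] [Module R N]
    (s : Finset T) (s' : Finset N) (hs' : ∀ x ∈ s', ∃ t : T, of t • x = x) :
    ∃ e : T, e * e = e ∧ (∀ t ∈ s, e * t = t ∧ t * e = t) ∧ ∀ x ∈ s', of e • x = x := by
  classical
  choose! t ht using hs'
  -- A left unit for `t x` also fixes `x = t x • x`.
  obtain ⟨e, he, he'⟩ := h (s ∪ s'.image t)
  refine ⟨e, he, fun t ht => he' t (by simp [ht]), fun x hx => ?_⟩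
  rw [← ht x hx, ← mul_smul, ← map_mul,
    (he' (t x) (Finset.mem_union_right _ (Finset.mem_image_of_mem _ hx))).1]

theorem isUnitary_of_span (h : HasLocalUnits T) {N : Type v} [AddCommGroup N] [Module R N]
    (S : Set N) (hS : Submodule.span R S = ⊤) (hx : ∀ x ∈ S, ∃ t : T, of t • x = x) :
    IsUnitary T N := by
  classical
  intro x
  have hx' : x ∈ Submodule.span R S := hS ▸ Submodule.mem_top
  induction hx' using Submodule.span_induction with
  | mem x hm => exact hx x hm
  | zero => exact ⟨0, by simp⟩
  | add x y _ _ hx hy =>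
    obtain ⟨e, -, -, he⟩ := h.exists_unit ∅ {x, y} (by
      intro z hz
      simp only [Finset.mem_insert, Finset.mem_singleton] at hz
      rcases hz with rfl | rfl <;> assumption)
    exact ⟨e, by rw [smul_add, he x (by simp), he y (by simp)]⟩
  | smul r x _ hx =>
    obtain ⟨t, ht⟩ := hx
    obtain ⟨t', ht'⟩ := Unitalization.exists_mul_of_eq r t
    obtain ⟨e, -, he⟩ := h {t'}
    refine ⟨e, ?_⟩
    rw [← ht, ← mul_smul r, ht', ← mul_smul, ← map_mul, (he t' (by simp)).1]

end HasLocalUnits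

theorem IsUnitary.of_injective {N N' : Type*} [AddCommGroup N] [Module R N] [AddCommGroup N']
    [Module R N'] (h : IsUnitary T N) (f : N' →ₗ[R] N) (hf : Function.Injective f) :
    IsUnitary T N' := fun x => by
  obtain ⟨t, ht⟩ := h (f x)
  exact ⟨t, hf (by rw [map_smul, ht])⟩

theorem IsUnitary.of_surjective {N N' : Type*} [AddCommGroup N] [Module R N] [AddCommGroup N']
    [Module R N'] (h : IsUnitary T N) (f : N →ₗ[R] N') (hf : Function.Surjective f) :
    IsUnitary T N' := fun x => by
  obtain ⟨y, rfl⟩ := hf x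
  obtain ⟨t, ht⟩ := h y
  exact ⟨t, by rw [← map_smul, ht]⟩

/-- The left ideal of the unitization generated by `e`. -/
abbrev leftIdeal (e : T) : Submodule R R := Submodule.span R {of e}

theorem mem_leftIdeal_iff {e : T} (he : e * e = e) (r : R) : r ∈ leftIdeal e ↔ r * of e = r := by
  rw [Submodule.mem_span_singleton]
  constructor
  · rintro ⟨a, rfl⟩
    rw [smul_eq_mul, mul_assoc, ← map_mul, he]
  · intro h
    exact ⟨r, h⟩

/-- Right multiplication by the idempotent is a retraction of `R` onto the ideal. -/
theorem leftIdeal_projective {e : T} (he : e * e = e) : Module.Projective R (leftIdeal e) := by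
  refine Module.Projective.of_split (M := R) (leftIdeal e).subtype
    (LinearMap.codRestrict (leftIdeal e) (LinearMap.toSpanSingleton R R (of e)) fun r => ?_) ?_
  · exact Submodule.mem_span_singleton.2 ⟨r, rfl⟩
  · ext ⟨x, hx⟩ : 2
    exact (mem_leftIdeal_iff he x).1 hx

theorem isUnitary_leftIdeal (h : HasLocalUnits T) (e : T) : IsUnitary T (leftIdeal e) := by
  intro ⟨x, hx⟩
  obtain ⟨a, rfl⟩ := Submodule.mem_span_singleton.1 hx
  obtain ⟨t', ht'⟩ := Unitalization.exists_mul_of_eq a e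
  obtain ⟨e', -, he'⟩ := h {t'}
  refine ⟨e', Subtype.ext ?_⟩
  change of e' * (a * of e) = a * of e
  rw [ht', ← map_mul, (he' t' (by simp)).1]

theorem HasLocalUnits.isUnitary_directSum (h : HasLocalUnits T) {ι : Type*} (N : ι → Type*)
    [∀ i, AddCommGroup (N i)] [∀ i, Module R (N i)] (hN : ∀ i, IsUnitary T (N i)) :
    IsUnitary T (⨁ i, N i) := by
  classical
  refine h.isUnitary_of_span (⋃ i, Set.range (DirectSum.lof R ι N i)) ?_ ?_
  · rw [eq_top_iff]
    intro x _
    induction x using DirectSum.induction_on with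
    | zero => exact Submodule.zero_mem _
    | of i x => exact Submodule.subset_span (Set.mem_iUnion.2 ⟨i, x, rfl⟩)
    | add x y hx hy => exact Submodule.add_mem _ (hx trivial) (hy trivial)
  · intro x hx
    obtain ⟨i, y, rfl⟩ := Set.mem_iUnion.1 hx
    obtain ⟨t, ht⟩ := hN i y
    exact ⟨t, by rw [← map_smul, ht]⟩

/-- Every unitary module is a quotient of a unitary projective module. -/
theorem HasLocalUnits.exists_projective_cover (h : HasLocalUnits T) (N : Type u) [AddCommGroup N]
    [Module R N] (hN : IsUnitary T N) :
    ∃ (P : Type u) (_ : AddCommGroup P) (_ : Module R P) (p : P →ₗ[R] N),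
      Module.Projective R P ∧ IsUnitary T P ∧ Function.Surjective p := by
  classical
  -- An idempotent fixing `x` makes `R e → N`, `r ↦ r x`, a map from a unitary projective module
  -- that hits `x` at `e`. The cover has one such summand for each `x`.
  have hu : ∀ x : N, ∃ e : T, e * e = e ∧ of e • x = x := fun x => by
    obtain ⟨e, he, -, hx⟩ := h.exists_unit ∅ {x} (fun x _ => hN x)
    exact ⟨e, he, hx x (by simp)⟩
  choose e he hx using hu
  have : ∀ x, Module.Projective R (leftIdeal (e x)) := fun x => leftIdeal_projective (he x)
  refine ⟨⨁ x : N, leftIdeal (e x), inferInstance, inferInstance,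
    DirectSum.toModule R N N fun x =>
      LinearMap.toSpanSingleton R N x ∘ₗ (leftIdeal (e x)).subtype, inferInstance,
    h.isUnitary_directSum _ fun x => isUnitary_leftIdeal h _, fun x => ?_⟩
  refine ⟨DirectSum.lof R N (fun x => leftIdeal (e x)) x
    ⟨of (e x), Submodule.mem_span_singleton_self _⟩, ?_⟩
  rw [DirectSum.toModule_lof]
  exact hx x

/-- A map from a finitely generated unitary module to a projective module factors through a
finitely generated projective unitary module. -/
theorem HasLocalUnits.exists_factor_projective (h : HasLocalUnits T) {F P : Type u}
    [AddCommGroup F] [Module R F] [AddCommGroup P] [Module R P] [Module.Finite R F]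
    (hF : IsUnitary T F) [Module.Projective R P] (φ : F →ₗ[R] P) :
    ∃ (Q : Type u) (_ : AddCommGroup Q) (_ : Module R Q) (a : F →ₗ[R] Q) (b : Q →ₗ[R] P),
      Module.Projective R Q ∧ Module.Finite R Q ∧ IsUnitary T Q ∧ b ∘ₗ a = φ := by
  classical
  obtain ⟨s, hs⟩ := Module.projective_def'.1 (inferInstance : Module.Projective R P)
  obtain ⟨G, hG⟩ := (inferInstance : Module.Finite R F).fg_top
  -- Embed `P` in a free module. Since `F` is finitely generated, only finitely many coordinates
  -- occur. They lie in the ideal `T` because each `x` equals some `t • x`. A right unit `e` for the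
  -- coordinates of the generators then confines the image to finitely many copies of `R e`.
  let ψ : F →ₗ[R] P →₀ R := s ∘ₗ φ
  let I : Finset P := G.biUnion fun x => (ψ x).support
  have hT : ∀ x : F, ∀ p : P, ∃ t : T, ψ x p = of t := fun x p => by
    obtain ⟨t, ht⟩ := hF x
    obtain ⟨t', ht'⟩ := Unitalization.exists_of_mul_eq t (ψ x p)
    exact ⟨t', by rw [← ht', ← smul_eq_mul, ← Finsupp.smul_apply, ← map_smul, ht]⟩
  choose c hc using hT
  obtain ⟨e, he, he'⟩ := h ((G ×ˢ I).image fun y => c y.1 y.2)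
  have hmem : ∀ x : F, (ψ x).support ⊆ I ∧ ∀ p, ψ x p ∈ leftIdeal e := by
    intro x
    have hx : x ∈ Submodule.span R (G : Set F) := hG ▸ Submodule.mem_top
    induction hx using Submodule.span_induction with
    | mem x hx =>
      have hI : (ψ x).support ⊆ I := Finset.subset_biUnion_of_mem (fun x => (ψ x).support) hx
      refine ⟨hI, fun p => ?_⟩
      by_cases hp : p ∈ I
      · rw [mem_leftIdeal_iff he, hc, ← map_mul, (he' (c x p) (Finset.mem_image.2
          ⟨(x, p), by simpa using ⟨hx, hp⟩, rfl⟩)).2]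
      · rw [Finsupp.notMem_support_iff.1 fun hp' => hp (hI hp')]
        exact Submodule.zero_mem _
    | zero => simp
    | add x y _ _ hx hy =>
      refine ⟨?_, fun p => ?_⟩
      · rw [map_add]
        exact Finsupp.support_add.trans (Finset.union_subset hx.1 hy.1)
      · rw [map_add]
        exact Submodule.add_mem _ (hx.2 p) (hy.2 p)
    | smul r x _ hx =>
      refine ⟨?_, fun p => ?_⟩
      · rw [map_smul]
        exact Finsupp.support_smul.trans hx.1
      · rw [map_smul]
        exact Submodule.smul_mem _ _ (hx.2 p)
  have := leftIdeal_projective he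
  have : Module.Finite R (leftIdeal e) := Module.Finite.span_singleton R (of e)
  let a : F →ₗ[R] I →₀ leftIdeal e := (Finsupp.linearEquivFunOnFinite R (leftIdeal e) I).symm ∘ₗ
    LinearMap.pi fun p : I => LinearMap.codRestrict (leftIdeal e) (Finsupp.lapply (p : P) ∘ₗ ψ)
      fun x => (hmem x).2 p
  let b : (I →₀ leftIdeal e) →ₗ[R] P :=
    Finsupp.lsum ℕ fun p => LinearMap.toSpanSingleton R P (p : P) ∘ₗ (leftIdeal e).subtype
  have hU : IsUnitary T (I →₀ leftIdeal e) :=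
    (h.isUnitary_directSum (fun _ : I => leftIdeal e) fun _ => isUnitary_leftIdeal h e).of_injective
      (finsuppLEquivDirectSum R (leftIdeal e) I).toLinearMap (LinearEquiv.injective _)
  have hP : Module.Projective R (I →₀ leftIdeal e) :=
    Module.Projective.of_equiv (finsuppLEquivDirectSum R (leftIdeal e) I).symm
  refine ⟨I →₀ leftIdeal e, inferInstance, inferInstance, a, b, inferInstance, inferInstance, hU,
    ?_⟩
  ext x
  have h1 : φ x = Finsupp.linearCombination R id (ψ x) := (LinearMap.congr_fun hs (φ x)).symm
  rw [h1, Finsupp.linearCombination_apply, Finsupp.sum_of_support_subset _ (hmem x).1 _ (by simp)]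
  change Finsupp.sum _ _ = _
  rw [Finsupp.sum_fintype _ _ (by simp), ← Finset.sum_coe_sort I]
  rfl

end LocalUnits

/-! ### Factorization through bounded projective dimension, and syzygies -/

section Syzygies

open Unitalization (of)

variable {T : Type u} [NonUnitalRing T]

local notation "R" => Unitalization T

variable (T) in
/-- Every map from a finitely presented unitary module to `N` factors through a module of projective
dimension at most `d`. -/
def FactorsThroughProjDim (d : ℕ) (N : Type u) [AddCommGroup N] [Module R N] : Prop :=
  ∀ (F : Type u) [AddCommGroup F] [Module R F] [Module.FinitePresentation R F], IsUnitary T F →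
    ∀ φ : F →ₗ[R] N, ∃ (G : Type u) (_ : AddCommGroup G) (_ : Module R G) (a : F →ₗ[R] G)
      (b : G →ₗ[R] N), HasProjectiveDimensionLT (ModuleCat.of R G) (d + 1) ∧ b ∘ₗ a = φ

theorem Module.Projective.hasProjectiveDimensionLT_one {S : Type u} [Ring S] (P : Type u)
    [AddCommGroup P] [Module S P] [Module.Projective S P] :
    HasProjectiveDimensionLT (ModuleCat.of S P) 1 :=
  projective_iff_hasProjectiveDimensionLT_one.1 ((IsProjective.iff_projective P).1 inferInstance)

theorem hasProjectiveDimensionLT_ker {S : Type u} [Ring S] {P G : Type u} [AddCommGroup P]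
    [Module S P] [AddCommGroup G] [Module S G] [Module.Projective S P] (f : P →ₗ[S] G)
    (hf : Function.Surjective f) (d : ℕ)
    (hG : HasProjectiveDimensionLT (ModuleCat.of S G) (d + 2)) :
    HasProjectiveDimensionLT (ModuleCat.of S (LinearMap.ker f)) (d + 1) := by
  have := Module.Projective.hasProjectiveDimensionLT_one (S := S) P
  exact (LinearMap.shortExact_shortComplexKer hf).hasProjectiveDimensionLT_X₁ (d + 1)
    (hasProjectiveDimensionLT_of_ge _ 1 (d + 1) (by omega)) hG

/-- A map from `F` to the kernel factors through a finitely generated projective `Q` on its way to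
`P`. The cokernel of `F → Q` is finitely presented and maps to `N`, hence factors through some `G`
of projective dimension at most `d + 1`. The kernel of a surjection from a projective module onto
`G` is the required intermediate module. -/
theorem FactorsThroughProjDim.ker (h : HasLocalUnits T) {d : ℕ} {P N : Type u} [AddCommGroup P]
    [Module R P] [AddCommGroup N] [Module R N] [Module.Projective R P]
    (hN : FactorsThroughProjDim T (d + 1) N) (p : P →ₗ[R] N) (hp : Function.Surjective p) :
    FactorsThroughProjDim T d (LinearMap.ker p) := by
  intro F _ _ _ hF φ
  obtain ⟨Q, _, _, a, b, _, _, hQ, hab⟩ :=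
    h.exists_factor_projective hF ((LinearMap.ker p).subtype ∘ₗ φ)
  have hpb : LinearMap.range a ≤ LinearMap.ker (p ∘ₗ b) := by
    rintro _ ⟨y, rfl⟩
    have := LinearMap.congr_fun hab y
    simp only [LinearMap.comp_apply, Submodule.subtype_apply] at this
    simp [this]
  have := Module.finitePresentation_of_projective R Q
  have : Module.FinitePresentation R (Q ⧸ LinearMap.range a) :=
    Module.finitePresentation_of_surjective (LinearMap.range a).mkQ (Submodule.mkQ_surjective _) (by
      rw [Submodule.ker_mkQ, LinearMap.range_eq_map]
      exact (Module.Finite.fg_top).map a)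
  obtain ⟨G, _, _, c, g, hG, hcg⟩ := hN (Q ⧸ LinearMap.range a)
    (hQ.of_surjective _ (Submodule.mkQ_surjective _)) ((LinearMap.range a).liftQ (p ∘ₗ b) hpb)
  -- The free summand makes the map onto `G` surjective. It need not be unitary or finitely
  -- generated, which is harmless: the intermediate module is only required to have bounded
  -- projective dimension.
  let q : (G →₀ R) →ₗ[R] G := Finsupp.linearCombination R id
  obtain ⟨l, hl⟩ := Module.projective_lifting_property p (g ∘ₗ q) hp
  let D : Q × (G →₀ R) →ₗ[R] G := (c ∘ₗ (LinearMap.range a).mkQ).coprod q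
  have hD : Function.Surjective D := fun x => ⟨(0, Finsupp.single x 1), by simp [D, q]⟩
  let D' : Q × (G →₀ R) →ₗ[R] P := b.coprod l
  have hDD' : p ∘ₗ D' = g ∘ₗ D := by
    refine LinearMap.prod_ext ?_ ?_
    · ext y
      have := LinearMap.congr_fun hcg ((LinearMap.range a).mkQ y)
      simpa [D, D'] using this.symm
    · rw [LinearMap.comp_assoc, LinearMap.comp_assoc, LinearMap.coprod_inr, LinearMap.coprod_inr,
        hl]
  refine ⟨LinearMap.ker D, inferInstance, inferInstance,
    LinearMap.codRestrict _ (LinearMap.inl R Q (G →₀ R) ∘ₗ a) fun y => ?_,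
    LinearMap.restrict D' fun y hy => ?_, hasProjectiveDimensionLT_ker D hD d hG, ?_⟩
  · have : (Submodule.Quotient.mk (a y) : Q ⧸ LinearMap.range a) = 0 :=
      (Submodule.Quotient.mk_eq_zero _).2 ⟨y, rfl⟩
    simp [D, this]
  · have := LinearMap.congr_fun hDD' y
    simpa [LinearMap.mem_ker.1 hy] using this
  · ext y
    change b (a y) + l 0 = _
    rw [map_zero, add_zero]
    exact LinearMap.congr_fun hab y

end Syzygies

/-! ### Translation between `T`-modules and modules over the unitalization -/

section Flatness

open Unitalization (of)

variable {T : Type u} [NonUnitalRing T]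

local notation "R" => Unitalization T

namespace NonUnitalModule

variable {N : Type v} [AddCommGroup N] [NonUnitalModule T N]

theorem smul_zero (t : T) : t • (0 : N) = 0 := by
  have := NonUnitalModule.smul_add t (0 : N) 0
  simpa using this

theorem zero_smul (x : N) : (0 : T) • x = 0 := by
  have := NonUnitalModule.add_smul (0 : T) 0 x
  simpa using this

variable (T N) in
/-- The action of a ring without unit as a biadditive map. -/
def smulHom : T →+ N →+ N where
  toFun t := { toFun := fun x => t • x, map_zero' := smul_zero t, map_add' := smul_add t }
  map_zero' := AddMonoidHom.ext fun x => zero_smul x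
  map_add' s t := AddMonoidHom.ext fun x => add_smul s t x

@[simp] theorem smulHom_apply (t : T) (x : N) : smulHom T N t x = t • x := rfl

end NonUnitalModule

namespace UnitaryMod

open NonUnitalModule

/-- A module over `T` as a module over the unitalization of `T`. -/
@[reducible] def toModule (N : UnitaryMod T) : Module R N where
  smul r x := r.toProd.1 • x + r.toProd.2 • x
  one_smul x := by
    change (1 : ℤ) • x + (0 : T) • x = x
    simp [NonUnitalModule.zero_smul]
  mul_smul r s x := by
    change (r.toProd.1 * s.toProd.1) • x +
      (r.toProd.1 • s.toProd.2 + s.toProd.1 • r.toProd.2 + r.toProd.2 * s.toProd.2) • x =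
      r.toProd.1 • (s.toProd.1 • x + s.toProd.2 • x) +
        r.toProd.2 • (s.toProd.1 • x + s.toProd.2 • x)
    have h1 (t : T) (y : N) (z : ℤ) : (z • t) • y = z • t • y :=
      DFunLike.congr_fun (map_zsmul (smulHom T N) z t) y
    have h2 (t : T) (y : N) (z : ℤ) : t • z • y = z • t • y := map_zsmul (smulHom T N t) z y
    simp only [NonUnitalModule.add_smul, NonUnitalModule.smul_add, NonUnitalModule.mul_smul, h1, h2,
      _root_.smul_add, SemigroupAction.mul_smul]
    abel
  smul_zero r := by
    change r.toProd.1 • (0 : N) + r.toProd.2 • (0 : N) = 0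
    simp [NonUnitalModule.smul_zero]
  smul_add r x y := by
    change r.toProd.1 • (x + y) + r.toProd.2 • (x + y) =
      r.toProd.1 • x + r.toProd.2 • x + (r.toProd.1 • y + r.toProd.2 • y)
    rw [_root_.smul_add, NonUnitalModule.smul_add]
    abel
  add_smul r s x := by
    change (r.toProd.1 + s.toProd.1) • x + (r.toProd.2 + s.toProd.2) • x =
      r.toProd.1 • x + r.toProd.2 • x + (s.toProd.1 • x + s.toProd.2 • x)
    rw [_root_.add_smul, NonUnitalModule.add_smul]
    abel
  zero_smul x := by
    change (0 : ℤ) • x + (0 : T) • x = 0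
    simp [NonUnitalModule.zero_smul]

theorem toModule_of_smul (N : UnitaryMod T) (t : T) (x : N) :
    let _ := N.toModule; of t • x = t • x := by
  change (0 : ℤ) • x + t • x = t • x
  simp

theorem isUnitary (h : HasLocalUnits T) (N : UnitaryMod T) :
    let _ := N.toModule; IsUnitary T N := by
  let _ := N.toModule
  refine h.isUnitary_of_span {x | ∃ (t : T) (n : N), t • n = x} ?_ ?_
  · rw [eq_top_iff]
    intro x _
    have hx : x ∈ AddSubgroup.closure {x : N | ∃ (t : T) (n : N), t • n = x} :=
      N.unitary ▸ AddSubgroup.mem_top x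
    exact (AddSubgroup.closure_le (K := (Submodule.span R
      {x : N | ∃ (t : T) (n : N), t • n = x}).toAddSubgroup)).2 Submodule.subset_span hx
  · rintro _ ⟨t, n, rfl⟩
    obtain ⟨e, -, he⟩ := h {t}
    refine ⟨e, ?_⟩
    rw [toModule_of_smul, ← NonUnitalModule.mul_smul, (he t (by simp)).1]

/-- A unitary module over the unitalization of `T` as a unitary module over `T`. -/
abbrev ofModule (N : Type u) [AddCommGroup N] [Module R N] (hN : IsUnitary T N) : UnitaryMod T where
  carrier := N
  module :=
    { smul := fun t x => of t • x
      smul_add := fun t x y => _root_.smul_add (of t) x y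
      add_smul := fun s t x => by
        change of (s + t) • x = of s • x + of t • x
        rw [map_add, _root_.add_smul]
      mul_smul := fun s t x => by
        change of (s * t) • x = of s • of t • x
        rw [map_mul, SemigroupAction.mul_smul] }
  unitary := by
    rw [eq_top_iff]
    intro x _
    obtain ⟨t, ht⟩ := hN x
    exact AddSubgroup.subset_closure ⟨t, x, ht⟩

/-- A linear map of unitary modules. -/
def ofLinearMap {N N' : Type u} [AddCommGroup N] [Module R N] [AddCommGroup N'] [Module R N']
    (hN : IsUnitary T N) (hN' : IsUnitary T N') (f : N →ₗ[R] N') :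
    Hom (ofModule N hN) (ofModule N' hN') where
  toFun := f.toAddMonoidHom
  map_smul t x := f.map_smul (of t) x

/-- The right action of the unitalization of `T` on a right `T`-module. -/
def rightAct (X : UnitaryMod Tᵐᵒᵖ) : R →+ X →+ X where
  toFun r := r.toProd.1 • AddMonoidHom.id X + smulHom Tᵐᵒᵖ X (MulOpposite.op r.toProd.2)
  map_zero' := by
    change (0 : ℤ) • AddMonoidHom.id X + smulHom Tᵐᵒᵖ X (MulOpposite.op 0) = 0
    simp
  map_add' r s := by
    change (r.toProd.1 + s.toProd.1) • AddMonoidHom.id X +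
      smulHom Tᵐᵒᵖ X (MulOpposite.op (r.toProd.2 + s.toProd.2)) = _
    rw [MulOpposite.op_add, map_add, _root_.add_smul]
    abel

theorem rightAct_apply (X : UnitaryMod Tᵐᵒᵖ) (r : R) (x : X) :
    X.rightAct r x = r.toProd.1 • x + MulOpposite.op r.toProd.2 • x := rfl

theorem rightAct_of_mul (X : UnitaryMod Tᵐᵒᵖ) (t : T) (r : R) (x : X) :
    X.rightAct (of t * r) x = X.rightAct r (MulOpposite.op t • x) := by
  rw [rightAct_apply, rightAct_apply]
  change (0 * r.toProd.1) • x +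
    MulOpposite.op ((0 : ℤ) • r.toProd.2 + r.toProd.1 • t + t * r.toProd.2) • x = _
  simp only [zero_mul, _root_.zero_smul, zero_add, MulOpposite.op_add, MulOpposite.op_mul,
    MulOpposite.op_smul, NonUnitalModule.add_smul, NonUnitalModule.mul_smul]
  simp only [← smulHom_apply, map_zsmul, AddMonoidHom.zsmul_apply]

theorem Hom.map_rightAct {X Y : UnitaryMod Tᵐᵒᵖ} (f : Hom X Y) (r : R) (x : X) :
    f.toFun (X.rightAct r x) = Y.rightAct r (f.toFun x) := by
  simp [rightAct_apply, f.map_smul]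

/-- Integers already pass through `⊗[ℤ]`, so balancing over `T` is the same as balancing over `R`.
-/
theorem tmul_smul_sub_mem_tensorRel (X : UnitaryMod Tᵐᵒᵖ) {N : Type u} [AddCommGroup N] [Module R N]
    (hN : IsUnitary T N) (x : X) (r : R) (n : N) :
    ((X.rightAct r x) ⊗ₜ[ℤ] n - x ⊗ₜ[ℤ] (r • n) : X ⊗[ℤ] N) ∈ tensorRel X (ofModule N hN) := by
  obtain ⟨z, t, rfl⟩ := Unitalization.exists_eq_zsmul_add r
  have h1 : X.rightAct (z • 1 + of t) x = z • x + MulOpposite.op t • x := by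
    rw [rightAct_apply]
    change (z * 1 + 0) • x + MulOpposite.op (z • (0 : T) + t) • x = _
    simp
  have h2 : (z • (1 : R) + of t) • n = z • n + of t • n := by
    rw [_root_.add_smul, smul_assoc, one_smul]
  rw [h1, h2, TensorProduct.add_tmul, TensorProduct.tmul_add, TensorProduct.smul_tmul,
    add_sub_add_left_eq_sub]
  exact AddSubgroup.subset_closure ⟨x, t, n, rfl⟩

end UnitaryMod

end Flatness

/-! ### Right exactness of the tensor product and an equational criterion for flatness -/

section FlatCriterion

open Unitalization (of)

variable {T : Type u} [NonUnitalRing T]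

local notation "R" => Unitalization T

namespace UnitaryMod

theorem tensorMap_mk {X Y : UnitaryMod Tᵐᵒᵖ} (f : Hom X Y) (N : UnitaryMod T) (z : X ⊗[ℤ] N) :
    tensorMap f N (QuotientAddGroup.mk z) =
      QuotientAddGroup.mk (LinearMap.rTensor N f.toFun.toIntLinearMap z) := rfl

theorem tensorMap_surjective {X Y : UnitaryMod Tᵐᵒᵖ} (f : Hom X Y) (N : UnitaryMod T)
    (hf : Function.Surjective f.toFun) : Function.Surjective (tensorMap f N) := by
  intro z
  obtain ⟨z, rfl⟩ := QuotientAddGroup.mk_surjective z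
  obtain ⟨w, rfl⟩ := LinearMap.rTensor_surjective (N : Type u) (g := f.toFun.toIntLinearMap) hf z
  exact ⟨QuotientAddGroup.mk w, rfl⟩

theorem tensorMap_exact {X Y Z : UnitaryMod Tᵐᵒᵖ} (f : Hom X Y) (g : Hom Y Z) (N : UnitaryMod T)
    (hfg : Function.Exact f.toFun g.toFun) (hg : Function.Surjective g.toFun) :
    Function.Exact (tensorMap f N) (tensorMap g N) := by
  have hex := rTensor_exact (N : Type u) (f := f.toFun.toIntLinearMap)
    (g := g.toFun.toIntLinearMap) hfg hg
  intro z
  constructor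
  · obtain ⟨z, rfl⟩ := QuotientAddGroup.mk_surjective z
    intro hz
    rw [tensorMap_mk, QuotientAddGroup.eq_zero_iff] at hz
    -- Balancing relations lift along the surjection `g`, so a preimage can be corrected to one
    -- lying in the kernel before the relations are imposed.
    have hle : tensorRel Z N ≤ (tensorRel Y N).map
        (LinearMap.rTensor N g.toFun.toIntLinearMap).toAddMonoidHom := by
      rw [tensorRel, AddSubgroup.closure_le]
      rintro _ ⟨x, t, n, rfl⟩
      obtain ⟨y, rfl⟩ := hg x
      refine ⟨_, AddSubgroup.subset_closure ⟨y, t, n, rfl⟩, ?_⟩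
      simp [g.map_smul]
    obtain ⟨r, hr, hrz⟩ := hle hz
    obtain ⟨x, hx⟩ := (hex (z - r)).1 (by rw [map_sub, sub_eq_zero]; exact hrz.symm)
    refine ⟨QuotientAddGroup.mk x, ?_⟩
    rw [tensorMap_mk, hx, QuotientAddGroup.mk_sub, (QuotientAddGroup.eq_zero_iff r).2 hr, sub_zero]
  · rintro ⟨z, rfl⟩
    obtain ⟨z, rfl⟩ := QuotientAddGroup.mk_surjective z
    rw [tensorMap_mk, tensorMap_mk, (hex _).2 ⟨z, rfl⟩]
    rfl

/-- The map `X ⊗ V → X` given by a functional on `V`. -/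
noncomputable def actMap (X : UnitaryMod Tᵐᵒᵖ) {V : Type u} [AddCommGroup V] [Module R V]
    (c : V →ₗ[R] R) : X ⊗[ℤ] V →+ X :=
  TensorProduct.liftAddHom (X.rightAct.comp c.toAddMonoidHom).flip (fun z x v => by
    change X.rightAct (c v) (z • x) = X.rightAct (c (z • v)) x
    rw [map_zsmul, map_zsmul, map_zsmul, AddMonoidHom.zsmul_apply])

@[simp] theorem actMap_tmul (X : UnitaryMod Tᵐᵒᵖ) {V : Type u} [AddCommGroup V] [Module R V]
    (c : V →ₗ[R] R) (x : X) (v : V) : X.actMap c (x ⊗ₜ v) = X.rightAct (c v) x := rfl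

theorem actMap_rTensor {X Y : UnitaryMod Tᵐᵒᵖ} (f : Hom X Y) {V : Type u} [AddCommGroup V]
    [Module R V] (c : V →ₗ[R] R) (w : X ⊗[ℤ] V) :
    Y.actMap c (LinearMap.rTensor V f.toFun.toIntLinearMap w) = f.toFun (X.actMap c w) := by
  induction w with
  | zero => simp
  | tmul x v => simp [f.map_rightAct]
  | add a b ha hb => rw [map_add, map_add, ha, hb, map_add, map_add]

/-- The vanishing of an element of a tensor product is witnessed by finitely many relations. -/
theorem exists_relations_of_mem_tensorRel (Y : UnitaryMod Tᵐᵒᵖ) {N V : Type u} [AddCommGroup N]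
    [Module R N] (hN : IsUnitary T N) [AddCommGroup V] [Module R V] (π : V →ₗ[R] N)
    (hπ : Function.Surjective π) (w : Y ⊗[ℤ] V)
    (hw : LinearMap.lTensor Y π.toAddMonoidHom.toIntLinearMap w ∈ tensorRel Y (ofModule N hN)) :
    ∃ κ : Finset V, (∀ k ∈ κ, π k = 0) ∧
      ∀ c : V →ₗ[R] R, (∀ k ∈ κ, c k = 0) → Y.actMap c w = 0 := by
  classical
  -- The elements with a finite witness form a subgroup. It contains lifts of the balancing
  -- relations, which every functional kills and which need no witness, and the elements `y ⊗ k`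
  -- with `π k = 0`, witnessed by `k`. These account for all of the preimage of `tensorRel`.
  let W : AddSubgroup (Y ⊗[ℤ] V) :=
    { carrier := {w | ∃ κ : Finset V, (∀ k ∈ κ, π k = 0) ∧
        ∀ c : V →ₗ[R] R, (∀ k ∈ κ, c k = 0) → Y.actMap c w = 0}
      zero_mem' := ⟨∅, by simp, by simp⟩
      add_mem' := by
        rintro a b ⟨κ, h1, h2⟩ ⟨κ', h1', h2'⟩
        refine ⟨κ ∪ κ', fun k hk => (Finset.mem_union.1 hk).elim (h1 k) (h1' k), fun c hc => ?_⟩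
        rw [map_add, h2 c fun k hk => hc k (Finset.mem_union_left _ hk),
          h2' c fun k hk => hc k (Finset.mem_union_right _ hk), add_zero]
      neg_mem' := by
        rintro a ⟨κ, h1, h2⟩
        exact ⟨κ, h1, fun c hc => by rw [map_neg, h2 c hc, neg_zero]⟩ }
  change w ∈ W
  have hrel : tensorRel Y (ofModule N hN) ≤
      W.map (LinearMap.lTensor Y π.toAddMonoidHom.toIntLinearMap).toAddMonoidHom := by
    rw [tensorRel, AddSubgroup.closure_le]
    rintro _ ⟨y, t, n, rfl⟩
    obtain ⟨v, rfl⟩ := hπ n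
    refine ⟨(MulOpposite.op t • y) ⊗ₜ v - y ⊗ₜ (of t • v), ⟨∅, by simp, fun c _ => ?_⟩, ?_⟩
    · rw [map_sub, actMap_tmul, actMap_tmul, c.map_smul, smul_eq_mul, rightAct_of_mul, sub_self]
    · change (MulOpposite.op t • y) ⊗ₜ[ℤ] (π v) - y ⊗ₜ[ℤ] (π (of t • v)) = _
      rw [π.map_smul]
      rfl
  have hker : ∀ v, LinearMap.lTensor Y π.toAddMonoidHom.toIntLinearMap v = 0 → v ∈ W := by
    intro v hv
    obtain ⟨v, rfl⟩ := (lTensor_exact (Y : Type u)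
      (f := (LinearMap.ker π).subtype.toAddMonoidHom.toIntLinearMap)
      (g := π.toAddMonoidHom.toIntLinearMap) (fun x => by simp) hπ v).1 hv
    clear hv
    induction v with
    | zero => rw [map_zero]; exact W.zero_mem
    | add a b ha hb => rw [map_add]; exact W.add_mem ha hb
    | tmul y k =>
      refine ⟨{(k : V)}, by simp, fun c hc => ?_⟩
      change Y.rightAct (c k) y = 0
      rw [hc k (by simp), map_zero, AddMonoidHom.zero_apply]
  obtain ⟨w', hw', hww'⟩ := hrel hw
  have := W.add_mem hw' (hker (w - w') (by rw [map_sub, sub_eq_zero]; exact hww'.symm))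
  rwa [add_sub_cancel] at this

/-- Modulo the relations, `∑ x ⊗ π v = ∑ x ⊗ c i v • b i` becomes `∑ (x · c i v) ⊗ b i`, and for
each `i` the left factors sum to zero. -/
theorem lTensor_mem_tensorRel (X : UnitaryMod Tᵐᵒᵖ) {N V : Type u} [AddCommGroup N]
    [Module R N] (hN : IsUnitary T N) [AddCommGroup V] [Module R V] (π : V →ₗ[R] N)
    {ι : Type*} (I : Finset ι) (c : ι → V →ₗ[R] R) (b : ι → N) (S : Finset (X × V))
    (hS : ∀ p ∈ S, π p.2 = ∑ i ∈ I, c i p.2 • b i)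
    (hc : ∀ i, X.actMap (c i) (∑ p ∈ S, p.1 ⊗ₜ[ℤ] p.2) = 0) :
    LinearMap.lTensor X π.toAddMonoidHom.toIntLinearMap (∑ p ∈ S, p.1 ⊗ₜ[ℤ] p.2) ∈
      tensorRel X (ofModule N hN) := by
  have h : ∑ i ∈ I, ∑ p ∈ S, ((X.rightAct (c i p.2) p.1) ⊗ₜ[ℤ] b i - p.1 ⊗ₜ[ℤ] (c i p.2 • b i)) ∈
      tensorRel X (ofModule N hN) :=
    AddSubgroup.sum_mem _ fun i _ => AddSubgroup.sum_mem _ fun p _ =>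
      X.tmul_smul_sub_mem_tensorRel hN _ _ _
  have h0 : ∀ i ∈ I, ∑ p ∈ S, (X.rightAct (c i p.2) p.1) ⊗ₜ[ℤ] b i = 0 := fun i _ => by
    rw [← TensorProduct.sum_tmul]
    have := hc i
    rw [map_sum] at this
    simp only [actMap_tmul] at this
    rw [this, TensorProduct.zero_tmul]
  simp only [Finset.sum_sub_distrib] at h
  rw [Finset.sum_congr rfl h0, Finset.sum_const_zero, zero_sub, Finset.sum_comm] at h
  rw [map_sum]
  have := AddSubgroup.neg_mem _ h
  rw [neg_neg] at this
  convert this using 1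
  refine Finset.sum_congr rfl fun p hp => ?_
  rw [← TensorProduct.tmul_sum, ← hS p hp]
  rfl

/-- Only injectivity needs the hypothesis. The vanishing of an element in `Y ⊗ N` uses finitely many
relations in `N`, which define a finitely presented unitary module mapping to `N`. Factoring that
map through a projective module and taking coordinates there gives functionals that kill those
relations. They annihilate the element over `Y`, hence over `X` as `f` is injective, and this makes
it zero in `X ⊗ N`. -/
theorem isFlat_of_factorsThroughProjDim_zero (h : HasLocalUnits T) (N : Type u) [AddCommGroup N]
    [Module R N] (hN : IsUnitary T N) (hf : FactorsThroughProjDim T 0 N) :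
    IsFlat (ofModule N hN) := by
  classical
  intro X Y Z f g hfg
  refine ⟨?_, tensorMap_exact f g _ hfg.2.1 hfg.2.2, tensorMap_surjective g _ hfg.2.2⟩
  rw [injective_iff_map_eq_zero]
  intro z hz
  obtain ⟨z, rfl⟩ := QuotientAddGroup.mk_surjective z
  obtain ⟨V, _, _, ⟨B⟩⟩ : ∃ (V : Type u) (_ : AddCommGroup V) (_ : Module R V),
      Nonempty (Module.Basis N R V) :=
    ⟨N →₀ R, inferInstance, inferInstance, ⟨Finsupp.basisSingleOne⟩⟩
  let π : V →ₗ[R] N := B.constr ℕ id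
  have hπ : Function.Surjective π := fun n => ⟨B n, by simp [π]⟩
  obtain ⟨w, rfl⟩ := LinearMap.lTensor_surjective (X : Type u)
    (g := π.toAddMonoidHom.toIntLinearMap) hπ z
  rw [tensorMap_mk, QuotientAddGroup.eq_zero_iff] at hz
  have hz' : LinearMap.lTensor Y π.toAddMonoidHom.toIntLinearMap
      (LinearMap.rTensor V f.toFun.toIntLinearMap w) ∈ tensorRel Y (ofModule N hN) := by
    convert hz using 1
    exact DFunLike.congr_fun ((LinearMap.lTensor_comp_rTensor _ _ _).trans
      (LinearMap.rTensor_comp_lTensor _ _ _).symm) w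
  obtain ⟨κ, hκ, hκ'⟩ := Y.exists_relations_of_mem_tensorRel hN π hπ _ hz'
  obtain ⟨S, rfl⟩ := TensorProduct.exists_finset w
  let s : Finset N := (κ.biUnion fun k => (B.repr k).support) ∪
    S.biUnion fun p => (B.repr p.2).support
  have hκs : ∀ k ∈ κ, (B.repr k).support ⊆ s := fun k hk =>
    (Finset.subset_biUnion_of_mem (fun k => (B.repr k).support) hk).trans Finset.subset_union_left
  have hSs : ∀ p ∈ S, (B.repr p.2).support ⊆ s := fun p hp =>
    (Finset.subset_biUnion_of_mem (fun p : X × V => (B.repr p.2).support) hp).trans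
      Finset.subset_union_right
  obtain ⟨e, -, -, he⟩ := h.exists_unit ∅ s fun x _ => hN x
  obtain ⟨W, _, _, ⟨B'⟩⟩ : ∃ (W : Type u) (_ : AddCommGroup W) (_ : Module R W),
      Nonempty (Module.Basis s R W) :=
    ⟨s →₀ R, inferInstance, inferInstance, ⟨Finsupp.basisSingleOne⟩⟩
  have : Module.Free R W := Module.Free.of_basis B'
  have : Module.Finite R W := Module.Finite.of_basis B'
  have := Module.finitePresentation_of_projective R W
  let r : V →ₗ[R] W := B.constr ℕ fun n => if hn : n ∈ s then B' ⟨n, hn⟩ else 0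
  let φ : W →ₗ[R] N := B'.constr ℕ Subtype.val
  have hr : ∀ v : V, (B.repr v).support ⊆ s → φ (r v) = π v := fun v hv => by
    rw [← B.linearCombination_repr v, Finsupp.linearCombination_apply,
      Finsupp.sum_of_support_subset _ hv _ (by simp)]
    simp only [map_sum, map_smul]
    refine Finset.sum_congr rfl fun n hn => ?_
    simp [r, φ, π, hn]
  -- The images of `κ` carry the vanishing over `Y`. The relations `B' n = e • B' n`, which hold in
  -- `N` by the choice of `e`, make the quotient unitary.
  let κ' : Finset W := κ.image r ∪ Finset.univ.image fun n : s => B' n - of e • B' n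
  let L : Submodule R W := Submodule.span R (κ' : Set W)
  have : Module.FinitePresentation R (W ⧸ L) :=
    Module.finitePresentation_of_surjective L.mkQ (Submodule.mkQ_surjective _)
      (by rw [Submodule.ker_mkQ]; exact ⟨κ', rfl⟩)
  have hU : IsUnitary T (W ⧸ L) := by
    refine h.isUnitary_of_span (Set.range (L.mkQ ∘ B')) ?_ ?_
    · rw [Set.range_comp, ← Submodule.map_span, B'.span_eq, Submodule.map_top, Submodule.range_mkQ]
    · rintro _ ⟨n, rfl⟩
      refine ⟨e, ?_⟩
      rw [Function.comp_apply, ← map_smul, eq_comm, ← sub_eq_zero, ← map_sub]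
      refine (Submodule.Quotient.mk_eq_zero L).2 (Submodule.subset_span ?_)
      exact Finset.mem_union_right _ (Finset.mem_image_of_mem _ (Finset.mem_univ n))
  have hLφ : L ≤ LinearMap.ker φ := by
    refine Submodule.span_le.2 fun k hk => ?_
    rcases Finset.mem_union.1 hk with hk | hk
    · obtain ⟨v, hv, rfl⟩ := Finset.mem_image.1 hk
      exact (hr v (hκs v hv)).trans (hκ v hv)
    · obtain ⟨n, -, rfl⟩ := Finset.mem_image.1 hk
      have hn : φ (B' n) = n := B'.constr_basis ℕ _ n
      simp [hn, he n n.2]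
  obtain ⟨G, _, _, a, b, hG, hab⟩ := hf (W ⧸ L) hU (L.liftQ _ hLφ)
  have hGp : Module.Projective R G :=
    (IsProjective.iff_projective G).2 (projective_iff_hasProjectiveDimensionLT_one.2 hG)
  obtain ⟨σ, hσ⟩ := Module.projective_def'.1 hGp
  let ρ : V →ₗ[R] G →₀ R := σ ∘ₗ a ∘ₗ L.mkQ ∘ₗ r
  rw [QuotientAddGroup.eq_zero_iff]
  refine X.lTensor_mem_tensorRel hN π (S.biUnion fun p => (ρ p.2).support)
    (fun γ => Finsupp.lapply γ ∘ₗ ρ) b S ?_ fun γ => ?_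
  · intro p hp
    have h1 : π p.2 = b (a (L.mkQ (r p.2))) :=
      (hr _ (hSs p hp)).symm.trans (LinearMap.congr_fun hab (L.mkQ (r p.2))).symm
    have h2 : a (L.mkQ (r p.2)) = Finsupp.linearCombination R id (ρ p.2) :=
      (LinearMap.congr_fun hσ (a (L.mkQ (r p.2)))).symm
    rw [h1, h2, Finsupp.linearCombination_apply,
      Finsupp.sum_of_support_subset _ (Finset.subset_biUnion_of_mem
        (fun p : X × V => (ρ p.2).support) hp) _ (by simp), map_sum]
    simp only [map_smul]
    rfl
  -- The coordinate functional factors through `W ⧸ L`, so it kills `κ`. The vanishing over `Y`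
  -- descends to `X` along the injection `f`.
  · refine hfg.1 ?_
    rw [← actMap_rTensor, map_zero]
    refine hκ' _ fun k hk => ?_
    have hk' : L.mkQ (r k) = 0 := (Submodule.Quotient.mk_eq_zero L).2
      (Submodule.subset_span (Finset.mem_union_left _ (Finset.mem_image_of_mem r hk)))
    simp only [ρ, LinearMap.comp_apply, hk', map_zero]

end UnitaryMod

end FlatCriterion

/-! ### Flat resolutions and the bound on the weak global dimension -/

section Resolutions

open Unitalization (of)

variable {T : Type u} [NonUnitalRing T]

local notation "R" => Unitalization T

theorem Module.Projective.factorsThroughProjDim_zero (P : Type u) [AddCommGroup P] [Module R P]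
    [Module.Projective R P] : FactorsThroughProjDim T 0 P := fun _ _ _ _ _ φ =>
  ⟨P, inferInstance, inferInstance, φ, LinearMap.id,
    Module.Projective.hasProjectiveDimensionLT_one P, LinearMap.id_comp _⟩

namespace UnitaryMod

/-- The composition of homomorphisms. -/
def Hom.comp {X Y Z : UnitaryMod T} (g : Hom Y Z) (f : Hom X Y) : Hom X Z where
  toFun := g.toFun.comp f.toFun
  map_smul t x := (congrArg g.toFun (f.map_smul t x)).trans (g.map_smul t (f.toFun x))

/-- Splicing a flat resolution of the kernel of a surjection from a flat module. -/
theorem HasFlatResolution.splice {P K N : UnitaryMod T} {m : ℕ} (hK : HasFlatResolution K m)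
    (i : Hom K P) (p : Hom P N) (hi : Function.Injective i.toFun)
    (hip : Function.Exact i.toFun p.toFun) (hp : Function.Surjective p.toFun) (hP : IsFlat P) :
    HasFlatResolution N (m + 1) := by
  obtain ⟨F, d, ε, hF, h0, hε, hdε, hd⟩ := hK
  refine ⟨fun j => Nat.casesOn j P F,
    fun j => Nat.casesOn j (i.comp ε) d, p, fun j => ?_, fun j hj => ?_,
    hp, ?_, fun j => ?_⟩
  · cases j
    · exact hP
    · exact hF _
  · cases j
    · omega
    · exact h0 _ (by omega)
  · intro y
    refine (hip y).trans ⟨?_, ?_⟩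
    · rintro ⟨k, rfl⟩
      obtain ⟨x, rfl⟩ := hε k
      exact ⟨x, rfl⟩
    · rintro ⟨x, rfl⟩
      exact ⟨ε.toFun x, rfl⟩
  · cases j
    · intro y
      refine Iff.trans ?_ (hdε y)
      change i.toFun (ε.toFun y) = 0 ↔ _
      rw [map_eq_zero_iff _ hi]
    · exact hd _

theorem isFlat_zero (N : UnitaryMod T) [Subsingleton N] : IsFlat N := by
  have h : ∀ X : UnitaryMod Tᵐᵒᵖ, Subsingleton (tensor X N) := fun X => by
    have : Subsingleton (X ⊗[ℤ] N) :=
      subsingleton_of_forall_eq 0 fun z => by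
        induction z with
        | zero => rfl
        | tmul x y => rw [Subsingleton.elim y 0, TensorProduct.tmul_zero]
        | add a b ha hb => rw [ha, hb, add_zero]
    exact Quotient.instSubsingletonQuotient _
  intro X Y Z f g _
  have := h X
  have := h Y
  have := h Z
  exact ⟨Function.injective_of_subsingleton _, fun y => ⟨fun _ => ⟨0, Subsingleton.elim _ _⟩,
    fun _ => Subsingleton.elim _ _⟩, fun z => ⟨0, Subsingleton.elim _ _⟩⟩

theorem hasFlatResolution_zero {F N : UnitaryMod T} (hF : IsFlat F) (ε : Hom F N)
    (hε : Function.Bijective ε.toFun) : HasFlatResolution N 0 := by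
  let Z : UnitaryMod T := ofModule PUnit fun x => ⟨0, Subsingleton.elim _ _⟩
  have hZ : Subsingleton Z := inferInstanceAs (Subsingleton PUnit)
  have hex : ∀ {A : UnitaryMod T} (f : Hom Z A) (g : A →+ F), Function.Injective g →
      Function.Exact f.toFun g := fun f g hg y => by
    rw [map_eq_zero_iff _ hg]
    exact ⟨fun h => ⟨0, by rw [map_zero, h]⟩, by
      rintro ⟨z, rfl⟩
      rw [Subsingleton.elim z 0, map_zero]⟩
  let d : ∀ A : UnitaryMod T, Hom Z A := fun A =>
    ⟨0, fun t x => (NonUnitalModule.smul_zero t).symm⟩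
  refine ⟨fun j => Nat.casesOn j F fun _ => Z, fun j => Nat.casesOn j (d F) fun _ => d Z, ε,
    fun j => ?_, fun j hj => ?_, hε.2, fun y => ?_, fun j => ?_⟩
  · cases j
    · exact hF
    · exact isFlat_zero Z
  · cases j
    · omega
    · exact hZ
  · rw [map_eq_zero_iff _ hε.1]
    exact ⟨fun h => ⟨0, by rw [map_zero, h]⟩, by rintro ⟨z, rfl⟩; rfl⟩
  · cases j <;> exact fun y => ⟨fun _ => ⟨0, Subsingleton.elim (α := Z) _ _⟩, fun _ => by
      rw [Subsingleton.elim (α := Z) y 0, map_zero]⟩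

theorem hasFlatResolution_ofModule (h : HasLocalUnits T) (d : ℕ) :
    ∀ (N : Type u) [AddCommGroup N] [Module R N] (hN : IsUnitary T N),
      FactorsThroughProjDim T d N → HasFlatResolution (ofModule N hN) d := by
  induction d with
  | zero =>
    intro N _ _ hN hf
    exact hasFlatResolution_zero (isFlat_of_factorsThroughProjDim_zero h N hN hf)
      (ofLinearMap hN hN LinearMap.id) Function.bijective_id
  | succ d ih =>
    intro N _ _ hN hf
    obtain ⟨P, _, _, p, _, hP, hp⟩ := h.exists_projective_cover N hN
    have hK := hP.of_injective (LinearMap.ker p).subtype Subtype.val_injective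
    refine (ih (LinearMap.ker p) hK (hf.ker h p hp)).splice
      (ofLinearMap hK hP (LinearMap.ker p).subtype) (ofLinearMap hP hN p) Subtype.val_injective ?_
      hp (isFlat_of_factorsThroughProjDim_zero h P hP
        (Module.Projective.factorsThroughProjDim_zero P))
    exact LinearMap.exact_subtype_ker_map p

theorem HasFlatResolution.of_bijective {N N' : UnitaryMod T} {m : ℕ} (hN : HasFlatResolution N m)
    (f : Hom N N') (hf : Function.Bijective f.toFun) : HasFlatResolution N' m := by
  obtain ⟨F, d, ε, hF, h0, hε, hdε, hd⟩ := hN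
  refine ⟨F, d, f.comp ε, hF, h0, hf.2.comp hε, fun y => ?_, hd⟩
  exact Iff.trans (map_eq_zero_iff _ hf.1) (hdε y)

end UnitaryMod

open UnitaryMod in
/-- The weak global dimension of a ring with local units is at most the supremum of the projective
dimensions of the finitely presented unitary modules. -/
theorem HasLocalUnits.weakGlobalDim_le (h : HasLocalUnits T) (d : ℕ)
    (hd : ∀ (F : Type u) [AddCommGroup F] [Module R F] [Module.FinitePresentation R F],
      IsUnitary T F → HasProjectiveDimensionLT (ModuleCat.of R F) (d + 1)) :
    weakGlobalDim T ≤ d := by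
  refine iSup_le fun N => sInf_le ⟨d, rfl, ?_⟩
  let _ := N.toModule
  refine (hasFlatResolution_ofModule h d N (N.isUnitary h) ?_).of_bijective
    ⟨AddMonoidHom.id N, fun t x => N.toModule_of_smul t x⟩ Function.bijective_id
  intro F _ _ _ hF φ
  -- Here `F` itself has bounded projective dimension and serves as the intermediate module.
  exact ⟨F, inferInstance, inferInstance, LinearMap.id, φ, hd F hF, LinearMap.comp_id _⟩

end Resolutions

/-! ### Closure properties and approximations in cluster tilting subcategories -/

section ClusterTiltingClosure

open Abelian

variable {A : Type u} [Category.{v} A] [Abelian A]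

theorem ExtVanishes.of_retract {X Y Z : A} {i : ℕ} (h : ExtVanishes X Y i) (s : Z ⟶ Y) (r : Y ⟶ Z)
    (hsr : s ≫ r = 𝟙 Z) : ExtVanishes X Z i := by
  let _ := HasExt.standard A
  have : Subsingleton (Ext.{max u v} X Y i) := h
  refine subsingleton_of_forall_eq (0 : Ext.{max u v} X Z i) fun x => ?_
  rw [← x.comp_mk₀_id, ← hsr, ← Ext.mk₀_comp_mk₀, ← Ext.comp_assoc_of_second_deg_zero,
    Subsingleton.elim (x.comp (Ext.mk₀ s) (add_zero i)) 0, Ext.zero_comp]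

theorem ExtVanishes.biprod {X Y Z : A} {i : ℕ} (hY : ExtVanishes X Y i) (hZ : ExtVanishes X Z i) :
    ExtVanishes X (Y ⊞ Z) i := by
  let _ := HasExt.standard A
  have : Subsingleton (Ext.{max u v} X Y i) := hY
  have : Subsingleton (Ext.{max u v} X Z i) := hZ
  refine subsingleton_of_forall_eq (0 : Ext.{max u v} X (Y ⊞ Z) i) fun x => ?_
  rw [← x.comp_mk₀_id, ← biprod.total, Ext.mk₀_add, Ext.comp_add, ← Ext.mk₀_comp_mk₀,
    ← Ext.mk₀_comp_mk₀, ← Ext.comp_assoc_of_second_deg_zero, ← Ext.comp_assoc_of_second_deg_zero,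
    Subsingleton.elim (x.comp (Ext.mk₀ biprod.fst) (add_zero i)) 0,
    Subsingleton.elim (x.comp (Ext.mk₀ biprod.snd) (add_zero i)) 0, Ext.zero_comp, Ext.zero_comp,
    add_zero]

theorem ExtVanishes.of_shortExact {X : A} {S : ShortComplex A} (hS : S.ShortExact) {i : ℕ}
    (h₃ : ExtVanishes X S.X₃ i) (h₂ : ExtVanishes X S.X₂ (i + 1)) : ExtVanishes X S.X₁ (i + 1) := by
  let _ := HasExt.standard A
  have : Subsingleton (Ext.{max u v} X S.X₃ i) := h₃
  have : Subsingleton (Ext.{max u v} X S.X₂ (i + 1)) := h₂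
  refine subsingleton_of_forall_eq (0 : Ext.{max u v} X S.X₁ (i + 1)) fun x => ?_
  obtain ⟨y, rfl⟩ := Ext.covariant_sequence_exact₁ X hS x (Subsingleton.elim _ _) rfl
  rw [Subsingleton.elim y 0, Ext.zero_comp]

/-- In degree one, lifting of maps replaces vanishing of the preceding term: the connecting map is
zero on maps that lift to the middle object. -/
theorem ExtVanishes.one_of_shortExact {X : A} {S : ShortComplex A} (hS : S.ShortExact)
    (h₃ : ∀ g : X ⟶ S.X₃, ∃ h : X ⟶ S.X₂, h ≫ S.g = g) (h₂ : ExtVanishes X S.X₂ 1) :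
    ExtVanishes X S.X₁ 1 := by
  let _ := HasExt.standard A
  have : Subsingleton (Ext.{max u v} X S.X₂ 1) := h₂
  refine subsingleton_of_forall_eq (0 : Ext.{max u v} X S.X₁ 1) fun x => ?_
  obtain ⟨y, rfl⟩ := Ext.covariant_sequence_exact₁ X hS x (Subsingleton.elim _ _) (zero_add 1)
  obtain ⟨g, rfl⟩ := Ext.homEquiv₀.symm.surjective y
  obtain ⟨h, rfl⟩ := h₃ g
  rw [Ext.homEquiv₀_symm_apply, ← Ext.mk₀_comp_mk₀, Ext.comp_assoc_of_second_deg_zero,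
    hS.comp_extClass, Ext.comp_zero]

namespace IsNClusterTilting

variable {n : ℕ} {M : ObjectProperty A}

theorem of_retract (hM : IsNClusterTilting n M) {Y Z : A} (hY : M Y) (s : Z ⟶ Y) (r : Y ⟶ Z)
    (hsr : s ≫ r = 𝟙 Z) : M Z := by
  have hY' : rightPerp n M Y := by rwa [hM.rightPerp_eq]
  rw [← hM.rightPerp_eq]
  exact fun i h0 hi X hX => (hY' i h0 hi X hX).of_retract s r hsr

theorem biprod (hM : IsNClusterTilting n M) {Y Z : A} (hY : M Y) (hZ : M Z) : M (Y ⊞ Z) := by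
  have hY' : rightPerp n M Y := by rwa [hM.rightPerp_eq]
  have hZ' : rightPerp n M Z := by rwa [hM.rightPerp_eq]
  rw [← hM.rightPerp_eq]
  exact fun i h0 hi X hX => (hY' i h0 hi X hX).biprod (hZ' i h0 hi X hX)

theorem of_isZero (hM : IsNClusterTilting n M) {Z : A} (hZ : IsZero Z) : M Z := by
  obtain ⟨Y, -, hY, -⟩ := hM.generating Z
  exact hM.of_retract hY 0 0 (hZ.eq_of_src _ _)

theorem extVanishes (hM : IsNClusterTilting n M) {X Y : A} (hX : M X) (hY : M Y) {i : ℕ}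
    (h0 : 0 < i) (hi : i < n) : ExtVanishes X Y i := by
  rw [← hM.rightPerp_eq] at hY
  exact hY i h0 hi X hX

/-- Right approximations are epimorphisms, and their kernels have more vanishing extensions. -/
theorem exists_approximation (hM : IsNClusterTilting n M) (K : A) :
    ∃ (Y : A) (θ : Y ⟶ K), M Y ∧ Epi θ ∧ (∀ (X : A) (g : X ⟶ K), M X → ∃ h : X ⟶ Y, h ≫ θ = g) ∧
      ∀ m, m < n → (∀ (i : ℕ) (X : A), 0 < i → i < m → M X → ExtVanishes X K i) →
        ∀ (i : ℕ) (X : A), 0 < i → i < m + 1 → M X → ExtVanishes X (kernel θ) i := by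
  obtain ⟨Y, θ, hY, hθ⟩ := hM.contravariantlyFinite K
  have hepi : Epi θ := by
    obtain ⟨Y', f, hY', hf⟩ := hM.generating K
    obtain ⟨h, rfl⟩ := hθ Y' f hY'
    exact epi_of_epi h θ
  refine ⟨Y, θ, hY, hepi, hθ, fun m hm hK i X h0 hi hX => ?_⟩
  have hS : (ShortComplex.mk (kernel.ι θ) θ (kernel.condition θ)).ShortExact :=
    { exact := ShortComplex.exact_kernel θ }
  -- Degree one uses the approximation property; higher degrees use dimension shifting from `K`.
  obtain rfl | ⟨j, hj, rfl⟩ : i = 1 ∨ ∃ j, 0 < j ∧ i = j + 1 := by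
    rcases i with _ | _ | j
    · omega
    · exact Or.inl rfl
    · exact Or.inr ⟨j + 1, by omega, rfl⟩
  · exact ExtVanishes.one_of_shortExact hS (fun g => hθ X g hX)
      (hM.extVanishes hX hY one_pos (by omega))
  · exact ExtVanishes.of_shortExact hS (hK j X hj (by omega) hX)
      (hM.extVanishes hX hY (by omega) (by omega))

end IsNClusterTilting

end ClusterTiltingClosure

/-! ### Local units of the functor ring -/

section FunctorRingUnits

open Filter

variable {Λ : Type u} [Ring Λ] {J : Type w} (U : J → FGModuleCat.{u} Λ)

open Classical in
/-- The injection of a summand. -/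
noncomputable def summandInclusion (α : J) : U α →ₗ[Λ] ⨁ α, (U α : Type u) :=
  DirectSum.lof Λ J (fun α => (U α : Type u)) α

/-- The projection onto a summand. -/
noncomputable def summandProjection (α : J) : (⨁ α, (U α : Type u)) →ₗ[Λ] U α :=
  DirectSum.component Λ J (fun α => (U α : Type u)) α

@[simp] theorem summandProjection_inclusion (α : J) (x : U α) :
    summandProjection U α (summandInclusion U α x) = x := by
  classical
  exact DirectSum.component.lof_self (M := fun α => (U α : Type u)) Λ α x

theorem summandProjection_inclusion_of_ne {α β : J} (h : α ≠ β) (x : U α) :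
    summandProjection U β (summandInclusion U α x) = 0 := by
  classical
  exact (DirectSum.component.of (M := fun α => (U α : Type u)) Λ β α x).trans (dif_neg h)

theorem summandIdempotent_apply (α : J) (x : ⨁ α, (U α : Type u)) :
    summandIdempotent U α x = summandInclusion U α (summandProjection U α x) := rfl

variable {U} in
theorem summand_hom_ext {A : Type*} [AddCommGroup A] [Module Λ A]
    {f g : (⨁ α, (U α : Type u)) →ₗ[Λ] A}
    (h : ∀ α, f ∘ₗ summandInclusion U α = g ∘ₗ summandInclusion U α) : f = g := by
  classical
  exact DirectSum.linearMap_ext Λ h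

/-- The idempotent of a finite set of summands. -/
noncomputable def finsetIdempotent (S : Finset J) : Module.End Λ (⨁ α, (U α : Type u)) :=
  ∑ α ∈ S, summandIdempotent U α

theorem finsetIdempotent_inclusion_of_mem {S : Finset J} {α : J} (hα : α ∈ S) (x : U α) :
    finsetIdempotent U S (summandInclusion U α x) = summandInclusion U α x := by
  rw [finsetIdempotent, LinearMap.sum_apply, Finset.sum_eq_single α]
  · rw [summandIdempotent_apply, summandProjection_inclusion]
  · intro β _ hβ
    rw [summandIdempotent_apply, summandProjection_inclusion_of_ne U hβ.symm, map_zero]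
  · exact fun h => (h hα).elim

theorem finsetIdempotent_inclusion_of_notMem {S : Finset J} {α : J} (hα : α ∉ S) (x : U α) :
    finsetIdempotent U S (summandInclusion U α x) = 0 := by
  rw [finsetIdempotent, LinearMap.sum_apply]
  refine Finset.sum_eq_zero fun β hβ => ?_
  rw [summandIdempotent_apply, summandProjection_inclusion_of_ne U (by rintro rfl; exact hα hβ),
    map_zero]

theorem finsetIdempotent_mul_self (S : Finset J) :
    finsetIdempotent U S * finsetIdempotent U S = finsetIdempotent U S := by
  refine summand_hom_ext fun α => LinearMap.ext fun x => ?_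
  by_cases hα : α ∈ S
  · simp [finsetIdempotent_inclusion_of_mem U hα]
  · simp [finsetIdempotent_inclusion_of_notMem U hα]

theorem eventually_finsetIdempotent_apply (y : ⨁ α, (U α : Type u)) :
    ∀ᶠ S in atTop, finsetIdempotent U S y = y := by
  classical
  induction y using DirectSum.induction_on with
  | zero => exact Eventually.of_forall fun S => map_zero _
  | of α x =>
    filter_upwards [eventually_ge_atTop {α}] with S hS
    exact finsetIdempotent_inclusion_of_mem U (hS (Finset.mem_singleton_self α)) x
  | add x y hx hy =>
    filter_upwards [hx, hy] with S h1 h2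
    rw [map_add, h1, h2]

theorem eventually_finsetIdempotent_comp {A : Type*} [AddCommGroup A] [Module Λ A]
    [Module.Finite Λ A] (f : A →ₗ[Λ] ⨁ α, (U α : Type u)) :
    ∀ᶠ S in atTop, finsetIdempotent U S ∘ₗ f = f := by
  obtain ⟨G, hG⟩ := (inferInstance : Module.Finite Λ A).fg_top
  have h : ∀ᶠ S in atTop, ∀ x ∈ G, finsetIdempotent U S (f x) = f x :=
    (eventually_all_finset G).2 fun x _ => eventually_finsetIdempotent_apply U (f x)
  filter_upwards [h] with S hS
  exact LinearMap.ext_on hG hS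

theorem mem_functorRing_iff (f : (Module.End Λ (⨁ α, (U α : Type u)))ᵐᵒᵖ) :
    f ∈ functorRing U ↔ {α | f.unop ∘ₗ summandInclusion U α ≠ 0}.Finite := by
  have : {α | f.unop ∘ₗ summandInclusion U α ≠ 0} =
      {α : J | MulOpposite.op (summandIdempotent U α) * f ≠ 0} := by
    ext α
    refine not_congr ⟨fun h => MulOpposite.unop_injective (LinearMap.ext fun x => ?_), fun h =>
      LinearMap.ext fun x => ?_⟩
    · exact LinearMap.congr_fun h (summandProjection U α x)
    · have := LinearMap.congr_fun (congrArg MulOpposite.unop h) (summandInclusion U α x)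
      change f.unop (summandInclusion U α (summandProjection U α (summandInclusion U α x))) = 0
        at this
      rwa [summandProjection_inclusion] at this
  rw [this]
  rfl

theorem finsetIdempotent_mem (S : Finset J) :
    MulOpposite.op (finsetIdempotent U S) ∈ functorRing U := by
  rw [mem_functorRing_iff]
  refine S.finite_toSet.subset fun α hα => ?_
  by_contra h
  exact hα (LinearMap.ext fun x => finsetIdempotent_inclusion_of_notMem U h x)

theorem eventually_comp_finsetIdempotent {A : Type*} [AddCommGroup A] [Module Λ A]
    (f : (⨁ α, (U α : Type u)) →ₗ[Λ] A) (hf : {α | f ∘ₗ summandInclusion U α ≠ 0}.Finite) :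
    ∀ᶠ S in atTop, f ∘ₗ finsetIdempotent U S = f := by
  filter_upwards [eventually_ge_atTop hf.toFinset] with S hS
  refine summand_hom_ext fun α => LinearMap.ext fun x => ?_
  by_cases hα : α ∈ S
  · simp [finsetIdempotent_inclusion_of_mem U hα]
  · have : f ∘ₗ summandInclusion U α = 0 := by
      by_contra h
      exact hα (hS (hf.mem_toFinset.2 h))
    have hx := LinearMap.congr_fun this x
    simp only [LinearMap.comp_apply, LinearMap.zero_apply] at hx ⊢
    rw [finsetIdempotent_inclusion_of_notMem U hα, map_zero, hx]

/-- An element of the functor ring lives on finitely many summands. Each is finitely generated, so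
its image lies in finitely many summands too. -/
theorem eventually_mul_finsetIdempotent (t : functorRing U) :
    ∀ᶠ S in atTop, (t : (Module.End Λ (⨁ α, (U α : Type u)))ᵐᵒᵖ) *
      MulOpposite.op (finsetIdempotent U S) = t := by
  have hf := (mem_functorRing_iff U t).1 t.2
  have h : ∀ᶠ S in atTop, ∀ α ∈ hf.toFinset, finsetIdempotent U S ∘ₗ
      (t : (Module.End Λ (⨁ α, (U α : Type u)))ᵐᵒᵖ).unop ∘ₗ summandInclusion U α =
        (t : (Module.End Λ (⨁ α, (U α : Type u)))ᵐᵒᵖ).unop ∘ₗ summandInclusion U α :=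
    (eventually_all_finset _).2 fun α _ => eventually_finsetIdempotent_comp U _
  filter_upwards [h] with S hS
  refine MulOpposite.unop_injective (summand_hom_ext fun α => ?_)
  change finsetIdempotent U S ∘ₗ t.1.unop ∘ₗ summandInclusion U α = _
  by_cases hα : t.1.unop ∘ₗ summandInclusion U α = 0
  · rw [hα, LinearMap.comp_zero]
  · exact hS α (hf.mem_toFinset.2 hα)

theorem hasLocalUnits_functorRing : HasLocalUnits (functorRing U) := by
  intro s
  have h : ∀ᶠ S in atTop, ∀ t ∈ s, t.1.unop ∘ₗ finsetIdempotent U S = t.1.unop ∧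
      t.1 * MulOpposite.op (finsetIdempotent U S) = t.1 :=
    (eventually_all_finset s).2 fun t _ =>
      (eventually_comp_finsetIdempotent U _ ((mem_functorRing_iff U t.1).1 t.2)).and
        (eventually_mul_finsetIdempotent U t)
  obtain ⟨S, hS⟩ := h.exists
  exact ⟨⟨_, finsetIdempotent_mem U S⟩, Subtype.ext
    (congrArg MulOpposite.op (finsetIdempotent_mul_self U S)), fun t ht =>
    ⟨Subtype.ext (congrArg MulOpposite.op (hS t ht).1), Subtype.ext (hS t ht).2⟩⟩

end FunctorRingUnits

/-! ### The modules `finiteHom U A` and the Yoneda lemma -/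

section HomFunctor

open Unitalization (of)

theorem Unitalization.map_smul_of_map_of_smul {T : Type u} [NonUnitalRing T] {N : Type v}
    {N' : Type w} [AddCommGroup N] [Module (Unitalization T) N] [AddCommGroup N']
    [Module (Unitalization T) N'] (f : N →+ N') (h : ∀ (t : T) (x : N), f (of t • x) = of t • f x)
    (r : Unitalization T) (x : N) : f (r • x) = r • f x := by
  obtain ⟨z, t, rfl⟩ := Unitalization.exists_eq_zsmul_add r
  rw [add_smul, add_smul, smul_assoc, smul_assoc, one_smul, one_smul, map_add, map_zsmul, h]

variable {Λ : Type u} [Ring Λ] {J : Type w} (U : J → FGModuleCat.{u} Λ)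

/-- The maps `⨁ U_α → A` that vanish on almost all `U_α`. -/
def finiteHom (A : FGModuleCat.{u} Λ) : AddSubgroup ((⨁ α, (U α : Type u)) →ₗ[Λ] A) where
  carrier := {g | {α | g ∘ₗ summandInclusion U α ≠ 0}.Finite}
  zero_mem' := by simp
  add_mem' {f g} hf hg := (hf.union hg).subset fun α hα => by
    by_contra h
    simp only [Set.mem_union, Set.mem_ofPred_eq, not_or, not_not] at h
    exact hα (by rw [LinearMap.add_comp, h.1, h.2, add_zero])
  neg_mem' {f} hf := hf.subset fun α hα h => hα (by rw [LinearMap.neg_comp, h, neg_zero])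

/-- The functor ring acts on maps from `⨁ U_α` by composition. -/
noncomputable def finiteHomUnitary (A : FGModuleCat.{u} Λ) : UnitaryMod (functorRing U) where
  carrier := finiteHom U A
  module :=
    { smul := fun t g => ⟨g.1 ∘ₗ t.1.unop, ((mem_functorRing_iff U t.1).1 t.2).subset
        fun α hα h => hα (by rw [LinearMap.comp_assoc, h, LinearMap.comp_zero])⟩
      smul_add := fun t x y => Subtype.ext (LinearMap.add_comp _ _ _)
      add_smul := fun s t x => Subtype.ext (LinearMap.comp_add _ _ _)
      mul_smul := fun s t x => rfl }
  unitary := by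
    rw [eq_top_iff]
    intro g _
    obtain ⟨S, hS⟩ := (eventually_comp_finsetIdempotent U g.1 g.2).exists
    exact AddSubgroup.subset_closure ⟨⟨_, finsetIdempotent_mem U S⟩, g, Subtype.ext hS⟩

noncomputable instance (A : FGModuleCat.{u} Λ) :
    Module (Unitalization (functorRing U)) (finiteHom U A) :=
  (finiteHomUnitary U A).toModule

local notation "R" => Unitalization (functorRing U)

theorem finiteHom_of_smul {A : FGModuleCat.{u} Λ} (t : functorRing U) (g : finiteHom U A) :
    ((of t • g : finiteHom U A) : (⨁ α, (U α : Type u)) →ₗ[Λ] A) = g.1 ∘ₗ t.1.unop :=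
  congrArg Subtype.val ((finiteHomUnitary U A).toModule_of_smul t g)

theorem isUnitary_finiteHom (A : FGModuleCat.{u} Λ) : IsUnitary (functorRing U) (finiteHom U A) :=
  (finiteHomUnitary U A).isUnitary (hasLocalUnits_functorRing U)

/-- Composition with a map on the right. -/
noncomputable def finiteHomMap {A B : FGModuleCat.{u} Λ} (d : A ⟶ B) :
    finiteHom U A →ₗ[R] finiteHom U B :=
  let f : finiteHom U A →+ finiteHom U B :=
    { toFun := fun g => ⟨d.hom.hom ∘ₗ g.1, g.2.subset fun α hα h =>
        hα (by rw [LinearMap.comp_assoc, h, LinearMap.comp_zero])⟩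
      map_zero' := Subtype.ext (LinearMap.comp_zero _)
      map_add' := fun x y => Subtype.ext (LinearMap.comp_add _ _ _) }
  { f with
    map_smul' := Unitalization.map_smul_of_map_of_smul f fun t x => Subtype.ext (by
      rw [finiteHom_of_smul]
      change d.hom.hom ∘ₗ (of t • x : finiteHom U A).1 = _
      rw [finiteHom_of_smul]
      rfl) }

theorem finiteHomMap_comp {A B C : FGModuleCat.{u} Λ} (d : A ⟶ B) (d' : B ⟶ C) :
    finiteHomMap U (d ≫ d') = finiteHomMap U d' ∘ₗ finiteHomMap U d := rfl

theorem finiteHomMap_id (A : FGModuleCat.{u} Λ) : finiteHomMap U (𝟙 A) = LinearMap.id := rfl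

/-- The restriction to a summand. -/
noncomputable def finiteHomComponent {A : FGModuleCat.{u} Λ} (α : J) : finiteHom U A →+ (U α ⟶ A) where
  toFun g := FGModuleCat.ofHom (g.1 ∘ₗ summandInclusion U α)
  map_zero' := rfl
  map_add' _ _ := rfl

variable {U} in
theorem finiteHom_ext {A : FGModuleCat.{u} Λ} {g g' : finiteHom U A}
    (h : ∀ α, finiteHomComponent U α g = finiteHomComponent U α g') : g = g' :=
  Subtype.ext (summand_hom_ext fun α => congrArg (fun f => f.hom.hom) (h α))

theorem finiteHomComponent_map {A B : FGModuleCat.{u} Λ} (d : A ⟶ B) (α : J) (g : finiteHom U A) :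
    finiteHomComponent U α (finiteHomMap U d g) = finiteHomComponent U α g ≫ d := rfl

/-- The extension by zero of a map on a summand. -/
noncomputable def finiteHomSingle {A : FGModuleCat.{u} Λ} (α : J) : (U α ⟶ A) →+ finiteHom U A where
  toFun f := ⟨f.hom.hom ∘ₗ summandProjection U α, (Set.finite_singleton α).subset fun β hβ => by
    by_contra h
    exact hβ (LinearMap.ext fun x => by
      simp [summandProjection_inclusion_of_ne U (Ne.symm (Ne.symm h))])⟩
  map_zero' := Subtype.ext (LinearMap.zero_comp _)
  map_add' _ _ := Subtype.ext (LinearMap.add_comp _ _ _)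

theorem finiteHomMap_single {A B : FGModuleCat.{u} Λ} (d : A ⟶ B) (α : J) (f : U α ⟶ A) :
    finiteHomMap U d (finiteHomSingle U α f) = finiteHomSingle U α (f ≫ d) := rfl

theorem eq_sum_finiteHomSingle {A : FGModuleCat.{u} Λ} (g : finiteHom U A) :
    ∃ S : Finset J, g = ∑ α ∈ S, finiteHomSingle U α (finiteHomComponent U α g) := by
  obtain ⟨S, hS⟩ := (eventually_comp_finsetIdempotent U g.1 g.2).exists
  refine ⟨S, Subtype.ext (hS.symm.trans (LinearMap.ext fun x => ?_))⟩
  rw [AddSubgroup.val_finsetSum, LinearMap.sum_apply, LinearMap.comp_apply, finsetIdempotent,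
    LinearMap.sum_apply, map_sum]
  rfl

theorem finiteHomMap_injective {A B : FGModuleCat.{u} Λ} (d : A ⟶ B) [Mono d] :
    Function.Injective (finiteHomMap U d) := fun g g' h => finiteHom_ext fun α => by
  rw [← cancel_mono d, ← finiteHomComponent_map, ← finiteHomComponent_map, h]

theorem finiteHomMap_surjective {A B : FGModuleCat.{u} Λ} (d : A ⟶ B)
    (hd : ∀ (α : J) (f : U α ⟶ B), ∃ f' : U α ⟶ A, f' ≫ d = f) :
    Function.Surjective (finiteHomMap U d) := fun g => by
  choose l hl using hd
  obtain ⟨S, hS⟩ := eq_sum_finiteHomSingle U g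
  refine ⟨∑ α ∈ S, finiteHomSingle U α (l α (finiteHomComponent U α g)), ?_⟩
  rw [map_sum]
  refine Eq.trans (Finset.sum_congr rfl fun α _ => ?_) hS.symm
  rw [finiteHomMap_single, hl]

/-- This is left exactness of Hom. The lifts to the kernel are chosen on each of the finitely many
summands that matter. -/
theorem finiteHomMap_exact_kernel [IsNoetherianRing Λ] {A B : FGModuleCat.{u} Λ} (d : A ⟶ B) :
    Function.Exact (finiteHomMap U (kernel.ι d)) (finiteHomMap U d) := fun g => by
  constructor
  · intro h
    have h' : ∀ α, finiteHomComponent U α g ≫ d = 0 := fun α => by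
      rw [← finiteHomComponent_map, h, map_zero]
    obtain ⟨S, hS⟩ := eq_sum_finiteHomSingle U g
    refine ⟨∑ α ∈ S, finiteHomSingle U α (kernel.lift d _ (h' α)), ?_⟩
    rw [map_sum]
    refine Eq.trans (Finset.sum_congr rfl fun α _ => ?_) hS.symm
    rw [finiteHomMap_single, kernel.lift_ι]
  · rintro ⟨g, rfl⟩
    refine finiteHom_ext fun α => ?_
    rw [finiteHomComponent_map, finiteHomComponent_map, Category.assoc, kernel.condition, map_zero,
      comp_zero]

/-- The map `Hom(⨁ U_β, U_α) → T` given by the injection of `U_α`. -/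
noncomputable def finiteHomToRing (α : J) : finiteHom U (U α) →ₗ[R] R :=
  let f : finiteHom U (U α) →+ R := of.toAddMonoidHom.comp
    { toFun := fun g => ⟨MulOpposite.op (summandInclusion U α ∘ₗ g.1),
        (mem_functorRing_iff U _).2 (g.2.subset fun β hβ h => hβ (by
          rw [MulOpposite.unop_op, LinearMap.comp_assoc, h, LinearMap.comp_zero]))⟩
      map_zero' := Subtype.ext (congrArg MulOpposite.op (LinearMap.comp_zero _))
      map_add' := fun x y => Subtype.ext (congrArg MulOpposite.op (LinearMap.comp_add _ _ _)) }
  { f with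
    map_smul' := Unitalization.map_smul_of_map_of_smul f fun t x => by
      rw [smul_eq_mul]
      refine Eq.trans (congrArg of (Subtype.ext (congrArg MulOpposite.op ?_))) (map_mul of t _)
      change summandInclusion U α ∘ₗ (of t • x : finiteHom U (U α)).1 = _
      rw [finiteHom_of_smul]
      rfl }

/-- The ring form of Yoneda: with `x` the generator it shows that `finiteHom U (U α)` is cyclic and
a retract of `R`, and with `x` the image of the generator it identifies the linear maps out of it.
-/
theorem finiteHomToRing_smul {A : FGModuleCat.{u} Λ} (α : J) (g : finiteHom U (U α))
    (x : finiteHom U A) :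
    finiteHomToRing U α g • x = finiteHomMap U (finiteHomComponent U α x) g :=
  Subtype.ext (finiteHom_of_smul U _ x)

/-- The generator of the module of maps to `U_α`. -/
noncomputable def finiteHomGen (α : J) : finiteHom U (U α) := finiteHomSingle U α (𝟙 (U α))

theorem finiteHomComponent_gen (α : J) : finiteHomComponent U α (finiteHomGen U α) = 𝟙 (U α) := by
  ext x
  exact summandProjection_inclusion U α x

theorem finiteHomToRing_smul_gen (α : J) (g : finiteHom U (U α)) :
    finiteHomToRing U α g • finiteHomGen U α = g := by
  rw [finiteHomToRing_smul, finiteHomComponent_gen, finiteHomMap_id, LinearMap.id_apply]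

theorem finiteHomToRing_gen (α : J) : finiteHomToRing U α (finiteHomGen U α) =
    of ⟨MulOpposite.op (finsetIdempotent U {α}), finsetIdempotent_mem U {α}⟩ := by
  refine congrArg of (Subtype.ext (congrArg MulOpposite.op ?_))
  rw [finsetIdempotent, Finset.sum_singleton]
  rfl

/-- The module of maps to `A` is a finitely generated projective module, and the maps out of it are
the expected ones. -/
structure IsRepresentableProjective (A : FGModuleCat.{u} Λ) : Prop where
  finite : Module.Finite R (finiteHom U A)
  projective : Module.Projective R (finiteHom U A)
  full : ∀ (B : FGModuleCat.{u} Λ) (φ : finiteHom U A →ₗ[R] finiteHom U B),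
    ∃ d : A ⟶ B, φ = finiteHomMap U d

namespace IsRepresentableProjective

theorem summand (α : J) : IsRepresentableProjective U (U α) where
  finite := Module.Finite.of_surjective (LinearMap.toSpanSingleton R _ (finiteHomGen U α))
    fun g => ⟨finiteHomToRing U α g, finiteHomToRing_smul_gen U α g⟩
  projective := Module.Projective.of_split (finiteHomToRing U α)
    (LinearMap.toSpanSingleton R _ (finiteHomGen U α))
    (LinearMap.ext (finiteHomToRing_smul_gen U α))
  full B φ := ⟨finiteHomComponent U α (φ (finiteHomGen U α)), LinearMap.ext fun g => by
    rw [← finiteHomToRing_smul, ← map_smul, finiteHomToRing_smul_gen]⟩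

variable {U}

theorem of_retract {A B : FGModuleCat.{u} Λ} (h : IsRepresentableProjective U A) (s : B ⟶ A)
    (r : A ⟶ B) (hsr : s ≫ r = 𝟙 B) : IsRepresentableProjective U B := by
  have := h.finite
  have := h.projective
  have hs : finiteHomMap U r ∘ₗ finiteHomMap U s = LinearMap.id := by
    rw [← finiteHomMap_comp, hsr, finiteHomMap_id]
  refine ⟨Module.Finite.of_surjective (finiteHomMap U r) fun g => ⟨_, LinearMap.congr_fun hs g⟩,
    Module.Projective.of_split _ _ hs, fun C φ => ?_⟩
  obtain ⟨d, hd⟩ := h.full C (φ ∘ₗ finiteHomMap U r)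
  refine ⟨s ≫ d, ?_⟩
  rw [finiteHomMap_comp, ← hd, LinearMap.comp_assoc, hs, LinearMap.comp_id]

theorem of_isZero {A : FGModuleCat.{u} Λ} (h : IsZero A) : IsRepresentableProjective U A := by
  have : Subsingleton (finiteHom U A) := ⟨fun g g' => finiteHom_ext fun α => h.eq_of_tgt _ _⟩
  exact ⟨inferInstance, inferInstance, fun B φ => ⟨0, LinearMap.ext fun g => by
    rw [Subsingleton.elim g 0, map_zero, map_zero]⟩⟩

end IsRepresentableProjective

theorem finiteHomMap_add {A B : FGModuleCat.{u} Λ} (d d' : A ⟶ B) :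
    finiteHomMap U (d + d') = finiteHomMap U d + finiteHomMap U d' := rfl

theorem finiteHomMap_biprod_total [IsNoetherianRing Λ] (A B : FGModuleCat.{u} Λ) :
    finiteHomMap U (biprod.inl : A ⟶ A ⊞ B) ∘ₗ finiteHomMap U biprod.fst +
      finiteHomMap U (biprod.inr : B ⟶ A ⊞ B) ∘ₗ finiteHomMap U biprod.snd = LinearMap.id := by
  rw [← finiteHomMap_comp, ← finiteHomMap_comp, ← finiteHomMap_id, ← biprod.total]
  rfl

theorem IsRepresentableProjective.biprod [IsNoetherianRing Λ] {A B : FGModuleCat.{u} Λ}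
    (hA : IsRepresentableProjective U A) (hB : IsRepresentableProjective U B) :
    IsRepresentableProjective U (A ⊞ B) := by
  have := hA.finite
  have := hA.projective
  have := hB.finite
  have := hB.projective
  have h := finiteHomMap_biprod_total U A B
  have hs : (finiteHomMap U (biprod.inl : A ⟶ A ⊞ B)).coprod (finiteHomMap U biprod.inr) ∘ₗ
      (finiteHomMap U biprod.fst).prod (finiteHomMap U (biprod.snd : A ⊞ B ⟶ B)) =
        LinearMap.id := by
    rw [LinearMap.coprod_comp_prod, h]
  refine ⟨Module.Finite.of_surjective ((finiteHomMap U biprod.inl).coprod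
    (finiteHomMap U biprod.inr)) fun g => ⟨_, LinearMap.congr_fun hs g⟩,
    Module.Projective.of_split _ _ hs, fun C φ => ?_⟩
  obtain ⟨d, hd⟩ := hA.full C (φ ∘ₗ finiteHomMap U biprod.inl)
  obtain ⟨d', hd'⟩ := hB.full C (φ ∘ₗ finiteHomMap U biprod.inr)
  refine ⟨biprod.desc d d', ?_⟩
  rw [biprod.desc_eq, finiteHomMap_add, finiteHomMap_comp, finiteHomMap_comp, ← hd, ← hd',
    LinearMap.comp_assoc, LinearMap.comp_assoc, ← LinearMap.comp_add, h, LinearMap.comp_id]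

end HomFunctor

/-! ### Projective dimension of finitely presented modules and the main theorem -/

section Main

open Unitalization (of)

instance IsArtinAlgebra.isArtinianRing (Λ : Type u) [Ring Λ] [IsArtinAlgebra Λ] :
    IsArtinianRing Λ := by
  obtain ⟨k, _, _, _, _⟩ := IsArtinAlgebra.exists_base (Λ := Λ)
  have : IsArtinian k Λ := inferInstance
  exact isArtinian_of_tower k this

variable {Λ : Type u} [Ring Λ]

theorem FGModuleCat.nontrivial_of_not_isZero {A : FGModuleCat.{u} Λ} (h : ¬ IsZero A) :
    Nontrivial A := by
  by_contra hA
  rw [not_nontrivial_iff_subsingleton] at hA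
  refine h ((IsZero.iff_id_eq_zero A).2 ?_)
  ext x
  exact Subsingleton.elim (α := A) _ _

theorem FGModuleCat.length_biprod [IsNoetherianRing Λ] {A Y Z : FGModuleCat.{u} Λ} (e : A ≅ Y ⊞ Z) :
    Module.length Λ A = Module.length Λ Y + Module.length Λ Z := by
  rw [← Module.length_prod]
  refine LinearEquiv.length_eq (LinearEquiv.ofLinearMap
    ((e.hom ≫ biprod.fst).hom.hom.prod (e.hom ≫ biprod.snd).hom.hom)
    ((biprod.inl ≫ e.inv).hom.hom.coprod (biprod.inr ≫ e.inv).hom.hom) ?_ ?_)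
  · have h (a b : FGModuleCat.{u} Λ) (f : a ⟶ A) (g : A ⟶ b) (k : a ⟶ b) (hk : f ≫ g = k) (x : a) :
        g.hom.hom (f.hom.hom x) = k.hom.hom x := by rw [← hk]; rfl
    refine LinearMap.prod_ext (LinearMap.ext fun x => Prod.ext ?_ ?_)
      (LinearMap.ext fun x => Prod.ext ?_ ?_)
    · simpa using h _ _ (biprod.inl ≫ e.inv) (e.hom ≫ biprod.fst) (𝟙 Y) (by simp) x
    · simpa using h _ _ (biprod.inl ≫ e.inv) (e.hom ≫ biprod.snd) 0 (by simp) x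
    · simpa using h _ _ (biprod.inr ≫ e.inv) (e.hom ≫ biprod.fst) 0 (by simp) x
    · simpa using h _ _ (biprod.inr ≫ e.inv) (e.hom ≫ biprod.snd) (𝟙 Z) (by simp) x
  · rw [LinearMap.coprod_comp_prod]
    have h : (e.hom ≫ biprod.fst) ≫ (biprod.inl ≫ e.inv) +
        (e.hom ≫ biprod.snd) ≫ (biprod.inr ≫ e.inv) = 𝟙 A := by
      rw [← cancel_epi e.inv, ← cancel_mono e.hom]
      simp [biprod.total]
    exact congrArg (fun f => f.hom.hom) h

variable [IsArtinAlgebra Λ] {n : ℕ} {M : ObjectProperty (FGModuleCat.{u} Λ)} {J : Type w}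
  {U : J → FGModuleCat.{u} Λ}

/-- Induction on length: a nonzero decomposable object splits into two objects of `M`, both shorter
because lengths over an artinian ring are finite and the summands are nonzero. -/
theorem IsNClusterTilting.isRepresentableProjective (hM : IsNClusterTilting n M)
    (hU : IsCompleteIndecomposableFamily M U) :
    ∀ (A : FGModuleCat.{u} Λ), M A → IsRepresentableProjective U A := by
  suffices h : ∀ (l : ℕ∞) (A : FGModuleCat.{u} Λ), Module.length Λ A = l → M A →
      IsRepresentableProjective U A from fun A => h _ A rfl
  intro l
  induction l using WellFoundedLT.induction with
  | ind l ih =>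
    intro A hl hA
    by_cases h0 : IsZero A
    · exact IsRepresentableProjective.of_isZero h0
    by_cases hind : Indecomposable A
    · obtain ⟨α, ⟨e⟩⟩ := hU.complete A hA hind
      exact (IsRepresentableProjective.summand U α).of_retract e.hom e.inv e.hom_inv_id
    · simp only [Indecomposable, h0, not_false_eq_true, true_and, not_forall, not_or] at hind
      obtain ⟨Y, Z, e, hY, hZ⟩ := hind
      have hlen := FGModuleCat.length_biprod e
      have := FGModuleCat.nontrivial_of_not_isZero hY
      have := FGModuleCat.nontrivial_of_not_isZero hZ
      have hYpos : 0 < Module.length Λ Y := Module.length_pos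
      have hZpos : 0 < Module.length Λ Z := Module.length_pos
      have hYart : IsArtinian Λ Y := isArtinian_of_fg_of_artinian'
      have hZart : IsArtinian Λ Z := isArtinian_of_fg_of_artinian'
      have hYtop : Module.length Λ Y ≠ ⊤ := Module.length_ne_top
      have hZtop : Module.length Λ Z ≠ ⊤ := Module.length_ne_top
      have hYM : M Y := hM.of_retract hA (biprod.inl ≫ e.inv) (e.hom ≫ biprod.fst) (by simp)
      have hZM : M Z := hM.of_retract hA (biprod.inr ≫ e.inv) (e.hom ≫ biprod.snd) (by simp)
      have h1 : Module.length Λ Y < l := by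
        rw [← hl, hlen, add_comm]
        exact ENat.lt_add_left hYtop hZpos
      have h2 : Module.length Λ Z < l := by
        rw [← hl, hlen]
        exact ENat.lt_add_left hZtop hYpos
      exact (IsRepresentableProjective.biprod U (ih _ h1 Y rfl hYM) (ih _ h2 Z rfl hZM)).of_retract
        e.hom e.inv e.hom_inv_id

local notation "R" => Unitalization (functorRing U)

/-- The projective dimension of the functor of maps to a module is bounded by the length of its
resolution by right approximations. -/
theorem IsNClusterTilting.hasProjectiveDimensionLT_finiteHom
    (hM : IsNClusterTilting n M) (hU : IsCompleteIndecomposableFamily M U) (j : ℕ) :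
    ∀ K : FGModuleCat.{u} Λ,
      (∀ (i : ℕ) (X : FGModuleCat.{u} Λ), 0 < i → i + j < n → M X → ExtVanishes X K i) →
        HasProjectiveDimensionLT (ModuleCat.of R (finiteHom U K)) (j + 1) := by
  induction j with
  | zero =>
    intro K hK
    have hMK : M K := by
      rw [← hM.rightPerp_eq]
      exact fun i h0 hi X hX => hK i X h0 hi hX
    have := (hM.isRepresentableProjective hU K hMK).projective
    exact Module.Projective.hasProjectiveDimensionLT_one _
  | succ j ih =>
    intro K hK
    obtain ⟨Y, θ, hY, _, hθ, hker⟩ := hM.exists_approximation K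
    have := (hM.isRepresentableProjective hU Y hY).projective
    have hYP := Module.Projective.hasProjectiveDimensionLT_one (S := R) (finiteHom U Y)
    -- The subtraction is not truncated, since `0 < i` and `i + j < n` force `j + 1 < n`.
    have hkerPD := ih (kernel θ) fun i X h0 hi hX =>
      hker (n - (j + 1)) (by omega) (fun i' X' h0' hi' hX' => hK i' X' h0' (by omega) hX') i X h0
        (by omega) hX
    have hS : (ModuleCat.shortComplexOfCompEqZero (finiteHomMap U (kernel.ι θ)) (finiteHomMap U θ)
        (finiteHomMap_exact_kernel U θ).linearMap_comp_eq_zero).ShortExact :=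
      ModuleCat.shortComplex_shortExact _ (finiteHomMap_exact_kernel U θ)
        (finiteHomMap_injective U _) (finiteHomMap_surjective U θ fun α f => hθ _ f (hU.mem α))
    exact hS.hasProjectiveDimensionLT_X₃ (j + 1) hkerPD
      (hasProjectiveDimensionLT_of_ge _ 1 (j + 1 + 1) (by omega))

/-- Every finitely generated unitary module is covered by a representable one. -/
theorem IsNClusterTilting.exists_cover (hM : IsNClusterTilting n M)
    (hU : IsCompleteIndecomposableFamily M U) {F : Type (max u w)} [AddCommGroup F] [Module R F]
    [Module.Finite R F] (hF : IsUnitary (functorRing U) F) :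
    ∃ (A : FGModuleCat.{u} Λ) (φ : finiteHom U A →ₗ[R] F), M A ∧ Function.Surjective φ := by
  let P : Submodule R F → Prop := fun N =>
    ∃ (A : FGModuleCat.{u} Λ) (φ : finiteHom U A →ₗ[R] F), M A ∧ N ≤ LinearMap.range φ
  have hbot : P ⊥ := by
    obtain ⟨A, -, hA, -⟩ := hM.generating (FGModuleCat.of Λ PUnit)
    exact ⟨A, 0, hA, bot_le⟩
  have hsup : ∀ N, P N → ∀ N', P N' → P (N ⊔ N') := by
    rintro N ⟨A, φ, hA, hφ⟩ N' ⟨A', φ', hA', hφ'⟩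
    have hsplit {X Y Z : FGModuleCat.{u} Λ} (s : X ⟶ Y) (r : Y ⟶ Z) (t : X ⟶ Z) (h : s ≫ r = t)
        (g : finiteHom U X) : finiteHomMap U r (finiteHomMap U s g) = finiteHomMap U t g := by
      rw [← h, finiteHomMap_comp, LinearMap.comp_apply]
    refine ⟨A ⊞ A', φ ∘ₗ finiteHomMap U biprod.fst + φ' ∘ₗ finiteHomMap U biprod.snd,
      hM.biprod hA hA', sup_le (hφ.trans ?_) (hφ'.trans ?_)⟩
    · rintro _ ⟨g, rfl⟩
      refine ⟨finiteHomMap U biprod.inl g, ?_⟩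
      rw [LinearMap.add_apply, LinearMap.comp_apply, LinearMap.comp_apply,
        hsplit _ _ _ biprod.inl_fst, hsplit _ _ _ biprod.inl_snd, finiteHomMap_id]
      change φ g + φ' 0 = φ g
      rw [map_zero, add_zero]
    · rintro _ ⟨g, rfl⟩
      refine ⟨finiteHomMap U biprod.inr g, ?_⟩
      rw [LinearMap.add_apply, LinearMap.comp_apply, LinearMap.comp_apply,
        hsplit _ _ _ biprod.inr_fst, hsplit _ _ _ biprod.inr_snd, finiteHomMap_id]
      change φ 0 + φ' g = φ' g
      rw [map_zero, zero_add]
  have hfg : ∀ N : Submodule R F, N.FG → P N := by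
    refine fun N hN => Submodule.fg_induction (motive := fun N _ => P N) (fun x => ?_)
      (fun N N' _ _ h h' => hsup N h N' h')
      N hN
    obtain ⟨t, ht⟩ := hF x
    obtain ⟨S, hS⟩ := (eventually_comp_finsetIdempotent U t.1.unop
      ((mem_functorRing_iff U t.1).1 t.2)).exists
    let e : J → functorRing U := fun α => ⟨_, finsetIdempotent_mem U {α}⟩
    -- Only finitely many `e α` act nontrivially on `t`, so `x` is the sum of its components `e α •
    -- x`, and each of them is hit by the map from `finiteHom U (U α)` that sends the generator to
    -- it.
    have het : ∑ α ∈ S, e α * t = t := by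
      have hsum : ((∑ α ∈ S, e α : functorRing U) : (Module.End Λ (⨁ α, (U α : Type u)))ᵐᵒᵖ) =
          MulOpposite.op (finsetIdempotent U S) := by
        rw [AddSubmonoidClass.coe_finsetSum, finsetIdempotent, Finset.op_sum]
        exact Finset.sum_congr rfl fun α _ => by simp [e, finsetIdempotent]
      rw [← Finset.sum_mul]
      exact Subtype.ext ((congrArg (· * t.1) hsum).trans (congrArg MulOpposite.op hS))
    have hx : x = ∑ α ∈ S, of (e α) • x := by
      conv_lhs => rw [← ht, ← het, map_sum, Finset.sum_smul]
      exact Finset.sum_congr rfl fun α _ => by rw [map_mul, mul_smul, ht]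
    have hle : Submodule.span R {x} ≤ S.sup fun α => Submodule.span R {of (e α) • x} := by
      rw [Submodule.span_singleton_le_iff_mem]
      have hsum : ∑ α ∈ S, of (e α) • x ∈ S.sup fun α => Submodule.span R {of (e α) • x} :=
        Submodule.sum_mem _ fun α hα =>
          Finset.le_sup (f := fun α => Submodule.span R {of (e α) • x}) hα
            (Submodule.mem_span_singleton_self _)
      rwa [← hx] at hsum
    have hP : P (S.sup fun α => Submodule.span R {of (e α) • x}) := by
      refine Finset.sup_induction hbot hsup fun α _ => ⟨U α,
        LinearMap.toSpanSingleton R F x ∘ₗ finiteHomToRing U α, hU.mem α, ?_⟩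
      rw [Submodule.span_singleton_le_iff_mem]
      refine ⟨finiteHomGen U α, ?_⟩
      rw [LinearMap.comp_apply, finiteHomToRing_gen]
      rfl
    obtain ⟨A, φ, hA, hφ⟩ := hP
    exact ⟨A, φ, hA, hle.trans hφ⟩
  obtain ⟨A, φ, hA, hφ⟩ := hfg ⊤ Module.Finite.fg_top
  exact ⟨A, φ, hA, LinearMap.range_eq_top.1 (top_le_iff.1 hφ)⟩

theorem IsNClusterTilting.hasProjectiveDimensionLT_of_finitePresentation (hn : 0 < n)
    (hM : IsNClusterTilting n M) (hU : IsCompleteIndecomposableFamily M U) (F : Type (max u w))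
    [AddCommGroup F] [Module R F] [Module.FinitePresentation R F]
    (hF : IsUnitary (functorRing U) F) :
    HasProjectiveDimensionLT (ModuleCat.of R F) (n + 2) := by
  obtain ⟨B₀, φ₀, hB₀, hφ₀⟩ := hM.exists_cover hU hF
  have hP₀ := hM.isRepresentableProjective hU B₀ hB₀
  have := hP₀.finite
  have := hP₀.projective
  have : Module.Finite R (LinearMap.ker φ₀) :=
    Module.Finite.iff_fg.2 (Module.FinitePresentation.fg_ker φ₀ hφ₀)
  obtain ⟨B₁, φ₁, hB₁, hφ₁⟩ := hM.exists_cover hU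
    ((isUnitary_finiteHom U B₀).of_injective (LinearMap.ker φ₀).subtype Subtype.val_injective)
  have hP₁ := hM.isRepresentableProjective hU B₁ hB₁
  have := hP₁.projective
  obtain ⟨d, hd⟩ := hP₁.full B₀ ((LinearMap.ker φ₀).subtype ∘ₗ φ₁)
  -- Composing with the inclusion of `ker φ₀` does not change the kernel of `φ₁`.
  have hex : Function.Exact (finiteHomMap U (kernel.ι d)) φ₁ := fun g => by
    rw [← finiteHomMap_exact_kernel U d g, ← hd]
    exact (map_eq_zero_iff (LinearMap.ker φ₀).subtype Subtype.val_injective).symm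
  have hS : (ModuleCat.shortComplexOfCompEqZero (finiteHomMap U (kernel.ι d)) φ₁
      hex.linearMap_comp_eq_zero).ShortExact :=
    ModuleCat.shortComplex_shortExact _ hex (finiteHomMap_injective U _) hφ₁
  have hK : HasProjectiveDimensionLT (ModuleCat.of R (finiteHom U (kernel d))) n := by
    -- With `n - 1` approximations allowed, no vanishing is required of `kernel d`: the condition `i
    -- + (n - 1) < n` excludes `i > 0`.
    have := hM.hasProjectiveDimensionLT_finiteHom hU (n - 1) (kernel d)
      fun i X h0 hi _ => absurd hi (by omega)
    rwa [Nat.sub_add_cancel hn] at this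
  have h₁ := Module.Projective.hasProjectiveDimensionLT_one (S := R) (finiteHom U B₁)
  have h₀ := Module.Projective.hasProjectiveDimensionLT_one (S := R) (finiteHom U B₀)
  have hker := hS.hasProjectiveDimensionLT_X₃ n hK
    (hasProjectiveDimensionLT_of_ge _ 1 (n + 1) (by omega))
  exact (LinearMap.shortExact_shortComplexKer hφ₀).hasProjectiveDimensionLT_X₃ (n + 1) hker
    (hasProjectiveDimensionLT_of_ge _ 1 (n + 2) (by omega))

end Main

theorem theorem1p2 (n : ℕ) (hn : 0 < n) (Λ : Type u) [Ring Λ] [IsArtinAlgebra Λ]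
    (M : ObjectProperty (FGModuleCat.{u} Λ)) (hM : IsNClusterTilting n M)
    (J : Type w) (U : J → FGModuleCat.{u} Λ) (hU : IsCompleteIndecomposableFamily M U) :
    weakGlobalDim (functorRing U) ≤ n + 1 := by
  refine ((hasLocalUnits_functorRing U).weakGlobalDim_le (n + 1) fun F _ _ _ hF =>
    hM.hasProjectiveDimensionLT_of_finitePresentation hn hU F hF).trans ?_
  exact_mod_cast le_rfl
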